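/- Let $G$ be a locally compact group and let $L^1(G)$ be its group algebra: the Banach space of complex $L^1$ functions for a left Haar measure, with the convolution product $(f*g)(x)=\int_G f(t)\,g(t^{-1}x)\,dt$. For a Banach algebra $A$ and a continuous bilinear functional $\varphi\colon A\times A\to\mathbb{C}$ put $$\operatorname{dist}(\varphi)=\inf\bigl\{\|\varphi-\psi\| : \psi(a,b)=\xi(ab)\ (a,b\in A)\text{ for some }\xi\in A^*\bigr\},$$ $$|\varphi|_{b}=\sup\bigl\{|\varphi(ab,c)-\varphi(a,bc)| : a,b,c\in A,\ \|a\|=\|b\|=\|c\|=1\bigr\},$$ $$|\varphi|_{zp}=\sup\bigl\{|\varphi(a,b)| : a,b\in A,\ \|a\|=\|b\|=1,\ ab=0\bigr\}$$ (with $\sup\emptyset=0$). The algebra $A$ is strongly zero product determined if there is a constant $\alpha$ such that $\operatorname{dist}(\varphi)\le\alpha|\varphi|_{zp}$ for all $\varphi$, and it has the strong property $\mathbb{B}$ if there is a constant $\beta$ such that $|\varphi|_b\le\beta|\varphi|_{zp}$ for all $\varphi$; the smallest such constants $\alpha,\beta\ge 0$ are denoted by $\alpha_A$ and $\beta_A$.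 Then $L^1(G)$ is strongly zero product determined, it has the strong property $\mathbb{B}$, and $$\alpha_{L^1(G)}\le\beta_{L^1(G)}\le 60\sqrt{27}\,\frac{1+\sin\frac{\pi}{10}}{1-2\sin\frac{\pi}{10}}.$$ -/

import Mathlib

set_option linter.unusedSectionVars false

section L1Convolution

open MeasureTheory Filter Topology Function
open scoped ENNReal Pointwise

variable {G : Type*} [Group G] [TopologicalSpace G] [IsTopologicalGroup G] [LocallyCompactSpace G]
  [MeasurableSpace G] [BorelSpace G] {μ : Measure G} [μ.IsHaarMeasure] [μ.Regular]

/-- The convolution `(f * g)(x) = ∫ f(t) g(t⁻¹x) dt` of complex functions on a group. -/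
noncomputable def convFun {G : Type*} [Group G] [MeasurableSpace G] (μ : Measure G)
    (f g : G → ℂ) (x : G) : ℂ :=
  ∫ t, f t * g (t⁻¹ * x) ∂μ

lemma haar_inv_le (W : Set G) (hWc : IsCompact (closure W)) :
    ∃ B : ℝ, ∀ U : Set G, IsOpen U → U ⊆ W → μ.inv U ≤ ENNReal.ofReal B * μ U := by
  obtain ⟨⟨g, g_cont⟩, g_comp, g_nonneg, g_one⟩ :
    ∃ g : C(G, ℝ), HasCompactSupport g ∧ 0 ≤ g ∧ g 1 ≠ 0 := exists_continuous_nonneg_pos 1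
  change HasCompactSupport g at g_comp
  change g 1 ≠ 0 at g_one
  have g_nn : (0 : G → ℝ) ≤ g := g_nonneg
  set ν := μ.inv
  set D : G → ℝ := fun y ↦ ∫ z, g (z⁻¹ * y) ∂ν with hD
  have D_cont : Continuous D := continuous_integral_apply_inv_mul g_cont g_comp
  have D_pos : ∀ x, 0 < D x := by
    intro x
    have C : Continuous (fun y ↦ g (y⁻¹ * x)) := by fun_prop
    apply (integral_pos_iff_support_of_nonneg _ _).2
    · apply C.isOpen_support.measure_pos ν
      exact ⟨x, by simpa using g_one⟩
    · exact fun y ↦ g_nn (y⁻¹ * x)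
    · apply C.integrable_of_hasCompactSupport
      exact g_comp.comp_homeomorph ((Homeomorph.inv G).trans (Homeomorph.mulRight x))
  have hI : 0 < ∫ x, g x ∂μ :=
    g_cont.integral_pos_of_hasCompactSupport_nonneg_nonzero g_comp g_nn g_one
  obtain ⟨B₀, hB₀⟩ := (hWc.bddAbove_image D_cont.continuousOn)
  obtain ⟨B, hB0, hB⟩ : ∃ B, 0 ≤ B ∧ ∀ x ∈ closure W, D x ≤ B :=
    ⟨max B₀ 0, le_max_right _ _, fun x hx ↦ (hB₀ ⟨x, hx, rfl⟩).trans (le_max_left _ _)⟩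
  refine ⟨B * (∫ x, g x ∂μ)⁻¹, fun U hU hUW ↦ ?_⟩
  rw [hU.measure_eq_iSup_isCompact]
  refine iSup_le fun K ↦ iSup_le fun hKU ↦ iSup_le fun hK ↦ ?_
  obtain ⟨⟨f, fc⟩, f1, f0, fs, f01⟩ := exists_continuous_one_zero_of_isCompact hK
    hU.isClosed_compl (Set.disjoint_compl_right_iff_subset.2 hKU)
  change HasCompactSupport f at fs
  change ∀ x, f x ∈ Set.Icc (0 : ℝ) 1 at f01
  have key := Measure.integral_isMulLeftInvariant_isMulRightInvariant_combo (μ := μ) (ν := ν)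
    fc fs g_cont g_comp g_nn g_one
  have fU : ∀ x, f x ≠ 0 → x ∈ U := fun x hx ↦ by
    by_contra h
    exact hx (f0 h)
  have hUfin : μ U ≠ ∞ :=
    ((measure_mono (hUW.trans subset_closure)).trans_lt hWc.measure_lt_top).ne
  have i1 : Integrable f ν := fc.integrable_of_hasCompactSupport fs
  have i2 : Integrable (fun y ↦ f y * (D y)⁻¹) ν := by
    refine Continuous.integrable_of_hasCompactSupport
      (fc.mul (D_cont.inv₀ fun x ↦ (D_pos x).ne')) fs.mul_right
  have e1 : ν K ≤ ENNReal.ofReal (∫ x, f x ∂ν) := by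
    rw [ofReal_integral_eq_lintegral_ofReal i1 (ae_of_all _ fun x ↦ (f01 x).1)]
    have h1 : K ⊆ {x | 1 ≤ ENNReal.ofReal (f x)} := fun x hx ↦ by
      have : f x = 1 := f1 hx
      simp [this]
    have h2 := mul_meas_ge_le_lintegral (μ := ν) (f := fun x ↦ ENNReal.ofReal (f x))
      (ENNReal.measurable_ofReal.comp fc.measurable) 1
    rw [one_mul] at h2
    exact (measure_mono h1).trans h2
  have e2 : ∫ x, f x ∂ν ≤ B * ∫ y, f y * (D y)⁻¹ ∂ν := by
    rw [← integral_const_mul]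
    refine integral_mono i1 (i2.const_mul B) fun x ↦ ?_
    by_cases hx : f x = 0
    · simp [hx]
    · have h1 : D x ≤ B := hB x (subset_closure (hUW (fU x hx)))
      have h2 := D_pos x
      have h3 := (f01 x).1
      show f x ≤ B * (f x * (D x)⁻¹)
      have : f x = D x * (f x * (D x)⁻¹) := by field_simp
      calc f x = D x * (f x * (D x)⁻¹) := this
        _ ≤ _ := by gcongr
  have e3 : ∫ x, f x ∂μ ≤ (μ U).toReal := by
    rw [← measureReal_def, ← setIntegral_one_eq_measureReal (μ := μ) (s := U),
      ← integral_indicator hU.measurableSet]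
    refine integral_mono (fc.integrable_of_hasCompactSupport fs) ?_ fun x ↦ ?_
    · exact (integrable_indicator_iff hU.measurableSet).2 (integrableOn_const hUfin)
    · by_cases hx : x ∈ U
      · simpa [hx] using (f01 x).2
      · simpa [hx] using (f0 hx).le
  calc ν K ≤ ENNReal.ofReal (∫ x, f x ∂ν) := e1
    _ ≤ ENNReal.ofReal (B * (∫ x, g x ∂μ)⁻¹ * (μ U).toReal) := by
      apply ENNReal.ofReal_le_ofReal
      have : ∫ y, f y * (D y)⁻¹ ∂ν = (∫ x, g x ∂μ)⁻¹ * ∫ x, f x ∂μ := by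
        rw [key]; field_simp; rfl
      rw [this] at e2
      refine e2.trans ?_
      rw [mul_assoc]
      gcongr
    _ = _ := by
      rw [ENNReal.ofReal_mul (by positivity), ENNReal.ofReal_toReal hUfin]

lemma haar_inv_null_inter {N C : Set G} (hN : μ N = 0) (hC : IsCompact C) : μ (N⁻¹ ∩ C) = 0 := by
  obtain ⟨W, hW, hCW, hWc⟩ := exists_isOpen_superset_and_isCompact_closure hC.inv
  obtain ⟨B, hB⟩ := haar_inv_le (μ := μ) W hWc
  refine nonpos_iff_eq_zero.1 (ENNReal.le_of_forall_pos_le_add fun ε hε _ ↦ ?_)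
  rw [zero_add]
  have : ENNReal.ofReal B * μ N < ε := by simpa [hN] using hε
  have h0 : (0 : ℝ≥0∞) < ε / (ENNReal.ofReal B + 1) := by
    apply ENNReal.div_pos <;> simp [hε.ne']
  obtain ⟨U, hNU, hU, hlt⟩ := N.exists_isOpen_lt_of_lt (μ := μ) _ (hN ▸ h0)
  have h1 : N⁻¹ ∩ C ⊆ (U ∩ W)⁻¹ := fun x hx ↦ ⟨hNU hx.1, hCW (by simpa using hx.2)⟩
  calc μ (N⁻¹ ∩ C) ≤ μ (U ∩ W)⁻¹ := measure_mono h1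
    _ = μ.inv (U ∩ W) := (Measure.inv_apply _ _).symm
    _ ≤ _ := hB _ (hU.inter hW) Set.inter_subset_right
    _ ≤ (ENNReal.ofReal B + 1) * (ε / (ENNReal.ofReal B + 1)) := by
      gcongr
      · exact le_self_add
      · exact (measure_mono Set.inter_subset_left).trans hlt.le
    _ ≤ ε := ENNReal.mul_div_le

lemma l1_translate_continuous (g : Lp ℂ 1 μ) :
    Continuous fun t : G ↦ DomMulAct.mk t⁻¹ • g := by
  have h : Continuous fun t : G ↦ DomMulAct.mk t⁻¹ :=
    DomMulAct.continuous_mk.comp continuous_inv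
  have : Fact ((1 : ℝ≥0∞) ≠ ∞) := ⟨ENNReal.one_ne_top⟩
  exact h.smul continuous_const

lemma l1_hasSum_ae (u : ℕ → Lp ℂ 1 μ) (g : Lp ℂ 1 μ) (hu : Summable fun n ↦ ‖u n‖)
    (hg : HasSum u g) : ∀ᵐ x ∂μ, (Summable fun n ↦ ‖u n x‖) ∧ HasSum (fun n ↦ u n x) (g x) := by
  have h1 : ∫⁻ x, ∑' n, ‖u n x‖ₑ ∂μ ≠ ∞ := by
    rw [lintegral_tsum fun n ↦ (Lp.aestronglyMeasurable (u n)).enorm]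
    have : ∀ n, ∫⁻ x, ‖u n x‖ₑ ∂μ = ‖u n‖ₑ := fun n ↦ by
      rw [Lp.enorm_def, eLpNorm_one_eq_lintegral_enorm]
    simp_rw [this]
    have := hu.tsum_ofReal_ne_top
    simpa [ofReal_norm] using this
  have h2 := ae_lt_top' (AEMeasurable.tsum fun n ↦ (Lp.aestronglyMeasurable (u n)).enorm) h1
  have h3 := (tendstoInMeasure_of_tendsto_Lp hg.tendsto_sum_nat).exists_seq_tendsto_ae
  obtain ⟨ns, hns, h3⟩ := h3
  have h4 : ∀ᵐ x ∂μ, ∀ n, (∑ i ∈ Finset.range n, u i : Lp ℂ 1 μ) x =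
      ∑ i ∈ Finset.range n, u i x := by
    rw [ae_all_iff]
    intro n
    filter_upwards [Lp.coeFn_finsetSum (Finset.range n) u] with x hx
    rw [hx, Finset.sum_apply]
  filter_upwards [h2, h3, h4] with x h2 h3 h4
  have hs : Summable fun n ↦ ‖u n x‖ := by
    have := ENNReal.summable_toReal h2.ne
    simpa using this
  refine ⟨hs, ?_⟩
  have hs' := hs.of_norm.hasSum
  have h5 := hs'.tendsto_sum_nat.comp hns.tendsto_atTop
  simp only [h4] at h3
  exact (tendsto_nhds_unique h5 h3) ▸ hs'

lemma l1_translate_coe (t : G) (g : Lp ℂ 1 μ) :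
    (DomMulAct.mk t⁻¹ • g : Lp ℂ 1 μ) =ᵐ[μ] fun x ↦ g (t⁻¹ * x) := by
  simpa using DomMulAct.smul_Lp_ae_eq (DomMulAct.mk t⁻¹) g

lemma l1_exists_series (g : Lp ℂ 1 μ) : ∃ (h : ℕ → G → ℂ) (u : ℕ → Lp ℂ 1 μ),
    (∀ n, Continuous (h n)) ∧ (∀ n, HasCompactSupport (h n)) ∧ (∀ n, u n =ᵐ[μ] h n) ∧
    (Summable fun n ↦ ‖u n‖) ∧ HasSum u g := by
  let S : AddSubgroup (Lp ℂ 1 μ) :=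
    { carrier := {v | ∃ h : G → ℂ, Continuous h ∧ HasCompactSupport h ∧ v =ᵐ[μ] h}
      zero_mem' := ⟨0, continuous_zero, HasCompactSupport.zero, Lp.coeFn_zero _ _ _⟩
      add_mem' := by
        rintro a b ⟨h, h1, h2, h3⟩ ⟨k, k1, k2, k3⟩
        exact ⟨h + k, h1.add k1, h2.add k2, (Lp.coeFn_add a b).trans (h3.add k3)⟩
      neg_mem' := by
        rintro a ⟨h, h1, h2, h3⟩
        exact ⟨-h, h1.neg, h2.neg, (Lp.coeFn_neg a).trans h3.neg⟩ }
  have hg : g ∈ S.topologicalClosure := by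
    refine Lp.induction ENNReal.one_ne_top (motive := fun v ↦ v ∈ S.topologicalClosure) ?_
      (fun f g hf hg _ h1 h2 ↦ add_mem h1 h2) S.isClosed_topologicalClosure g
    intro c s hs hμs
    rw [Lp.simpleFunc.coe_indicatorConst]
    change _ ∈ closure (S : Set (Lp ℂ 1 μ))
    rw [Metric.mem_closure_iff]
    intro ε hε
    have hδ : 0 < ε / (2 * (‖c‖ + 1)) := by positivity
    set δ := ε / (2 * (‖c‖ + 1)) with hδdef
    have hδ' : ENNReal.ofReal δ ≠ 0 := by simpa using hδ
    obtain ⟨K, hKs, hK, hKc, hKμ⟩ := hs.exists_isCompact_isClosed_sdiff_lt hμs.ne hδ'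
    obtain ⟨U, hKU, hU, hUlt, hUμ⟩ :=
      hKc.measurableSet.exists_isOpen_sdiff_lt (μ := μ) hK.measure_lt_top.ne hδ'
    obtain ⟨⟨f, fc⟩, f1, f0, fs, f01⟩ := exists_continuous_one_zero_of_isCompact hK
      hU.isClosed_compl (Set.disjoint_compl_right_iff_subset.2 hKU)
    change HasCompactSupport f at fs
    change ∀ x, f x ∈ Set.Icc (0 : ℝ) 1 at f01
    have kc : Continuous fun x ↦ (f x : ℂ) * c := by fun_prop
    have ks : HasCompactSupport fun x ↦ (f x : ℂ) * c :=
      (fs.comp_left (g := fun r : ℝ ↦ (r : ℂ)) (by simp)).mul_right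
    have ki : Integrable (fun x ↦ (f x : ℂ) * c) μ := kc.integrable_of_hasCompactSupport ks
    refine ⟨ki.toL1 _, ⟨_, kc, ks, ki.coeFn_toL1⟩, ?_⟩
    rw [dist_eq_norm, L1.norm_eq_integral_norm]
    have m1 : MeasurableSet (U \ K) := hU.measurableSet.diff hKc.measurableSet
    have m2 : MeasurableSet (s \ K) := hs.diff hKc.measurableSet
    have n1 : μ (U \ K) ≠ ∞ := (hUμ.trans_le le_top).ne
    have n2 : μ (s \ K) ≠ ∞ := (hKμ.trans_le le_top).ne
    have i1 : Integrable ((U \ K).indicator fun _ ↦ ‖c‖) μ :=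
      (integrable_indicator_iff m1).2 (integrableOn_const n1)
    have i2 : Integrable ((s \ K).indicator fun _ ↦ ‖c‖) μ :=
      (integrable_indicator_iff m2).2 (integrableOn_const n2)
    have hle : ∫ x, ‖(indicatorConstLp 1 hs hμs.ne c - ki.toL1 _ : Lp ℂ 1 μ) x‖ ∂μ ≤
        ∫ x, ((U \ K).indicator (fun _ ↦ ‖c‖) x + (s \ K).indicator (fun _ ↦ ‖c‖) x) ∂μ := by
      refine integral_mono_ae (L1.integrable_coeFn _).norm (i1.add i2) ?_
      filter_upwards [Lp.coeFn_sub (indicatorConstLp 1 hs hμs.ne c) (ki.toL1 _), ki.coeFn_toL1,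
        indicatorConstLp_coeFn (p := 1) (hs := hs) (hμs := hμs.ne) (c := c)] with x h1 h2 h3
      rw [h1, Pi.sub_apply, h2, h3]
      by_cases hxK : x ∈ K
      · have h4 : f x = 1 := f1 hxK
        have h5 : x ∈ s := hKs hxK
        simp [hxK, h4, h5]
      · have hc1 : ‖c - (f x : ℂ) * c‖ ≤ ‖c‖ := by
          have h4 : c - (f x : ℂ) * c = ((1 - f x : ℝ) : ℂ) * c := by push_cast; ring
          rw [h4, norm_mul, Complex.norm_real, Real.norm_eq_abs,
            abs_of_nonneg (by linarith [(f01 x).2])]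
          exact mul_le_of_le_one_left (norm_nonneg _) (by linarith [(f01 x).1])
        have hc2 : ‖(f x : ℂ) * c‖ ≤ ‖c‖ := by
          rw [norm_mul, Complex.norm_real, Real.norm_eq_abs, abs_of_nonneg (f01 x).1]
          exact mul_le_of_le_one_left (norm_nonneg _) (f01 x).2
        by_cases hxU : x ∈ U <;> by_cases hxs : x ∈ s
        · simp only [hxs, hxU, hxK, Set.indicator_of_mem, Set.mem_sdiff, not_false_iff, and_self]
          linarith [norm_nonneg c]
        · simpa [hxs, hxU, hxK] using hc2
        · have h4 : f x = 0 := f0 hxU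
          simp [hxs, hxU, hxK, h4]
        · have h4 : f x = 0 := f0 hxU
          simp [hxs, hxU, h4]
    refine hle.trans_lt ?_
    rw [integral_add i1 i2, integral_indicator_const _ m1, integral_indicator_const _ m2]
    have r1 : μ.real (U \ K) ≤ δ := ENNReal.toReal_le_of_le_ofReal hδ.le hUμ.le
    have r2 : μ.real (s \ K) ≤ δ := ENNReal.toReal_le_of_le_ofReal hδ.le hKμ.le
    have r3 : δ * (2 * (‖c‖ + 1)) = ε := by rw [hδdef]; field_simp
    simp only [smul_eq_mul]
    nlinarith [norm_nonneg c, mul_le_mul_of_nonneg_right r1 (norm_nonneg c),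
      mul_le_mul_of_nonneg_right r2 (norm_nonneg c)]
  change g ∈ closure (S : Set (Lp ℂ 1 μ)) at hg
  obtain ⟨v, v1, v2, -, v3⟩ := controlled_sum_of_mem_closure hg
    (b := fun n ↦ (1 / 2 : ℝ) ^ n) (fun n ↦ by positivity)
  choose h h1 h2 h3 using v2
  have hs : Summable fun n ↦ ‖v n‖ := by
    rw [← summable_nat_add_iff 1]
    exact Summable.of_nonneg_of_le (fun n ↦ norm_nonneg _) (fun n ↦ (v3 (n + 1) (by simp)).le)
      ((summable_nat_add_iff 1).2 summable_geometric_two)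
  refine ⟨h, v, h1, h2, h3, hs, ?_⟩
  have := hs.of_norm.hasSum
  exact (tendsto_nhds_unique (this.tendsto_sum_nat.comp (tendsto_add_atTop_nat 1)) v1) ▸ this

lemma l1_integrable_smul_translate {f : G → ℂ} (hf : Integrable f μ) (g : Lp ℂ 1 μ) :
    Integrable (fun t ↦ f t • (DomMulAct.mk t⁻¹ • g : Lp ℂ 1 μ)) μ := by
  have hm : AEStronglyMeasurable (fun t ↦ f t • (DomMulAct.mk t⁻¹ • g : Lp ℂ 1 μ)) μ := by
    obtain ⟨h, u, h1, h2, h3, h4, h5⟩ := l1_exists_series (hf.toL1 f)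
    refine aestronglyMeasurable_of_tendsto_ae atTop
      (f := fun n t ↦ (∑ i ∈ Finset.range n, h i t) • (DomMulAct.mk t⁻¹ • g : Lp ℂ 1 μ))
      (fun n ↦ ?_) ?_
    · refine (Continuous.stronglyMeasurable_of_hasCompactSupport ?_ ?_).aestronglyMeasurable
      · exact (continuous_finsetSum _ fun i _ ↦ h1 i).smul (l1_translate_continuous g)
      · refine HasCompactSupport.smul_right (f := fun t ↦ ∑ i ∈ Finset.range n, h i t) ?_
        induction n with
        | zero => simpa using! HasCompactSupport.zero
        | succ n ih => simpa [Finset.sum_range_succ] using! ih.add (h2 n)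
    · filter_upwards [l1_hasSum_ae u _ h4 h5, ae_all_iff.2 h3, hf.coeFn_toL1] with t a b c
      have := a.2.tendsto_sum_nat
      simp only [b, c] at this
      exact this.smul_const _
  refine (hf.norm.mul_const ‖g‖).mono' hm (ae_of_all _ fun t ↦ ?_)
  rw [norm_smul, DomMulAct.norm_smul_Lp]

/-- The `L¹`-valued Bochner integral `∫ f(t) • g(t⁻¹ ·) dt`. It is only a tool for showing that
`convFun μ f g` is again in `L¹`, with which it agrees almost everywhere. -/
noncomputable def l1BochnerConv : Lp ℂ 1 μ →L[ℂ] Lp ℂ 1 μ →L[ℂ] Lp ℂ 1 μ :=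
  LinearMap.mkContinuous₂
    (LinearMap.mk₂ ℂ (fun f g ↦ ∫ t, f t • (DomMulAct.mk t⁻¹ • g : Lp ℂ 1 μ) ∂μ)
      (fun f f' g ↦ by
        rw [← integral_add (l1_integrable_smul_translate (L1.integrable_coeFn f) g)
          (l1_integrable_smul_translate (L1.integrable_coeFn f') g)]
        refine integral_congr_ae ?_
        filter_upwards [Lp.coeFn_add f f'] with t h
        rw [h, Pi.add_apply, add_smul])
      (fun c f g ↦ by
        rw [← integral_smul]
        refine integral_congr_ae ?_
        filter_upwards [Lp.coeFn_smul c f] with t h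
        rw [h, Pi.smul_apply, smul_assoc])
      (fun f g g' ↦ by
        rw [← integral_add (l1_integrable_smul_translate (L1.integrable_coeFn f) g)
          (l1_integrable_smul_translate (L1.integrable_coeFn f) g')]
        refine integral_congr_ae (ae_of_all _ fun t ↦ ?_)
        simp only [smul_add])
      (fun c f g ↦ by
        rw [← integral_smul]
        refine integral_congr_ae (ae_of_all _ fun t ↦ ?_)
        simp only
        rw [smul_comm (DomMulAct.mk t⁻¹) c g, smul_comm]))
    1 fun f g ↦ by
      rw [LinearMap.mk₂_apply, one_mul, L1.norm_eq_integral_norm f, ← integral_mul_const]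
      refine (norm_integral_le_integral_norm _).trans (le_of_eq ?_)
      simp only [norm_smul, DomMulAct.norm_smul_Lp]

lemma l1BochnerConv_apply (f g : Lp ℂ 1 μ) :
    l1BochnerConv f g = ∫ t, f t • (DomMulAct.mk t⁻¹ • g : Lp ℂ 1 μ) ∂μ := rfl

lemma l1BochnerConv_norm_le (f g : Lp ℂ 1 μ) : ‖l1BochnerConv f g‖ ≤ ‖f‖ * ‖g‖ := by
  rw [l1BochnerConv_apply, L1.norm_eq_integral_norm f, ← integral_mul_const]
  refine (norm_integral_le_integral_norm _).trans (le_of_eq ?_)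
  simp only [norm_smul, DomMulAct.norm_smul_Lp]

/-- Integration over a set, as a functional on `L¹`. -/
noncomputable def l1SetIntegral (s : Set G) : Lp ℂ 1 μ →L[ℂ] ℂ :=
  LinearMap.mkContinuous
    { toFun := fun g ↦ ∫ x in s, g x ∂μ
      map_add' := fun f g ↦ by
        rw [← integral_add (L1.integrable_coeFn f).integrableOn
          (L1.integrable_coeFn g).integrableOn]
        exact integral_congr_ae (ae_restrict_of_ae (Lp.coeFn_add f g))
      map_smul' := fun c f ↦ by
        rw [RingHom.id_apply, ← integral_smul]
        exact integral_congr_ae (ae_restrict_of_ae (Lp.coeFn_smul c f)) }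
    1 fun f ↦ by
      rw [one_mul, L1.norm_eq_integral_norm]
      exact (norm_integral_le_integral_norm _).trans
        (setIntegral_le_integral (L1.integrable_coeFn f).norm (ae_of_all _ fun x ↦ norm_nonneg _))

lemma conv_cc {f g : G → ℂ} (fc : Continuous f) (fs : HasCompactSupport f) (gc : Continuous g)
    (gs : HasCompactSupport g) {u v : Lp ℂ 1 μ} (hu : u =ᵐ[μ] f) (hv : v =ᵐ[μ] g) :
    l1BochnerConv u v =ᵐ[μ] convFun μ f g := by
  have hc : Continuous (convFun μ f g) := by
    rw [← continuousOn_univ]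
    refine continuousOn_integral_of_compact_support fs ?_ ?_
    · exact Continuous.continuousOn (by fun_prop)
    · intro p x _ hx
      simp [image_eq_zero_of_notMem_tsupport hx]
  have hmul : ∀ t x, f t * g (t⁻¹ * x) ≠ 0 → t ∈ tsupport f ∧ x ∈ tsupport f * tsupport g := by
    intro t x h
    have h1 : t ∈ tsupport f := subset_closure (left_ne_zero_of_mul h)
    have h2 : t⁻¹ * x ∈ tsupport g := subset_closure (right_ne_zero_of_mul h)
    exact ⟨h1, ⟨t, h1, t⁻¹ * x, h2, by simp⟩⟩
  have hK : IsCompact (tsupport f * tsupport g) := fs.isCompact.mul gs.isCompact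
  have hs : HasCompactSupport (convFun μ f g) := by
    refine HasCompactSupport.of_support_subset_isCompact hK fun x hx ↦ ?_
    by_contra hx'
    refine hx (integral_eq_zero_of_ae (ae_of_all _ fun t ↦ ?_))
    by_contra h
    exact hx' (hmul t x h).2
  refine Integrable.ae_eq_of_forall_setIntegral_eq _ _ (L1.integrable_coeFn _)
    (hc.integrable_of_hasCompactSupport hs) fun s hs _ ↦ ?_
  have hint := l1_integrable_smul_translate (L1.integrable_coeFn u) v
  change l1SetIntegral s (l1BochnerConv u v) = _
  rw [l1BochnerConv_apply, ← ContinuousLinearMap.integral_comp_comm _ hint]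
  have e : ∫ t, l1SetIntegral s (u t • (DomMulAct.mk t⁻¹ • v : Lp ℂ 1 μ)) ∂μ
      = ∫ t, ∫ x in s, f t * g (t⁻¹ * x) ∂μ ∂μ := by
    refine integral_congr_ae ?_
    filter_upwards [hu] with t ht
    rw [map_smul, smul_eq_mul, ht, integral_const_mul]
    congr 1
    refine integral_congr_ae (ae_restrict_of_ae ?_)
    have hv' := (measurePreserving_mul_left μ t⁻¹).quasiMeasurePreserving.ae hv
    filter_upwards [l1_translate_coe t v, hv'] with x h1 h2
    rw [h1, h2]
  rw [e]
  refine integral_integral_swap_of_hasCompactSupport (by fun_prop) ?_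
  refine HasCompactSupport.of_support_subset_isCompact (fs.isCompact.prod hK) ?_
  rintro ⟨t, x⟩ h
  exact hmul t x h


lemma conv_series {F : ℕ → G → ℂ} {H : G → ℂ} (h1 : ∀ n, Integrable (F n) μ)
    (h2 : Summable fun n ↦ ∫ t, ‖F n t‖ ∂μ) (h3 : ∀ᵐ t ∂μ, HasSum (fun n ↦ F n t) (H t)) :
    HasSum (fun n ↦ ∫ t, F n t ∂μ) (∫ t, H t ∂μ) := by
  have := hasSum_integral_of_summable_integral_norm h1 h2
  rwa [integral_congr_ae (h3.mono fun t ht ↦ ht.tsum_eq)] at this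

lemma l1_conv_hasSum_left {u : ℕ → Lp ℂ 1 μ} {f : Lp ℂ 1 μ} (hu : Summable fun n ↦ ‖u n‖)
    (hf : HasSum u f) (g : Lp ℂ 1 μ) :
    ∀ᵐ x ∂μ, HasSum (fun n ↦ l1BochnerConv (u n) g x) (l1BochnerConv f g x) := by
  have e : HasSum (fun n ↦ l1BochnerConv.flip g (u n)) (l1BochnerConv.flip g f) :=
    ContinuousLinearMap.hasSum _ hf
  simp only [ContinuousLinearMap.flip_apply] at e
  have := l1_hasSum_ae (fun n ↦ l1BochnerConv (u n) g) (l1BochnerConv f g)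
    (Summable.of_nonneg_of_le (fun _ ↦ norm_nonneg _) (fun n ↦ l1BochnerConv_norm_le _ _)
      (hu.mul_right _)) e
  exact this.mono fun x hx ↦ hx.2

lemma conv_lc (f : Lp ℂ 1 μ) {g : G → ℂ} (gc : Continuous g)
    (gs : HasCompactSupport g) {v : Lp ℂ 1 μ} (hv : v =ᵐ[μ] g) :
    l1BochnerConv f v =ᵐ[μ] convFun μ f g := by
  obtain ⟨h, u, hc, hs, hu, hsum, hf⟩ := l1_exists_series f
  obtain ⟨M, hM⟩ := gs.exists_bound_of_continuous gc
  filter_upwards [l1_conv_hasSum_left hsum hf v,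
    ae_all_iff.2 fun n ↦ conv_cc (hc n) (hs n) gc gs (hu n) hv] with x h1 h2
  simp only [h2] at h1
  refine h1.unique (conv_series (fun n ↦ ?_) ?_ ?_)
  · exact Continuous.integrable_of_hasCompactSupport (by fun_prop) (hs n).mul_right
  · refine Summable.of_nonneg_of_le (fun n ↦ integral_nonneg fun t ↦ norm_nonneg _)
      (fun n ↦ ?_) (hsum.mul_right M)
    have e : ‖u n‖ = ∫ t, ‖h n t‖ ∂μ := by
      rw [L1.norm_eq_integral_norm]
      exact integral_congr_ae ((hu n).mono fun t ht ↦ by simp only [ht])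
    rw [e, ← integral_mul_const]
    refine integral_mono (f := fun t ↦ ‖h n t * g (t⁻¹ * x)‖) ?_ ?_ fun t ↦ ?_
    · have : Continuous fun t ↦ h n t * g (t⁻¹ * x) := by fun_prop
      exact (this.integrable_of_hasCompactSupport (hs n).mul_right).norm
    · exact ((hc n).integrable_of_hasCompactSupport (hs n)).norm.mul_const M
    · change ‖h n t * g (t⁻¹ * x)‖ ≤ _
      rw [norm_mul]
      exact mul_le_mul_of_nonneg_left (hM _) (norm_nonneg _)
  · filter_upwards [l1_hasSum_ae u f hsum hf, ae_all_iff.2 hu] with t a b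
    simp only [b] at a
    exact a.2.mul_right _

lemma l1_exists_norm (f : Lp ℂ 1 μ) : ∃ f' : Lp ℂ 1 μ, f' =ᵐ[μ] (fun t ↦ (‖f t‖ : ℂ)) := by
  have h : Integrable (fun t ↦ (‖f t‖ : ℂ)) μ := (L1.integrable_coeFn f).norm.ofReal
  exact ⟨h.toL1 _, h.coeFn_toL1⟩

lemma l1_ae_inv (f : Lp ℂ 1 μ) {p : G → Prop} (hp : ∀ᵐ y ∂μ, p y) (x : G) :
    ∀ᵐ t ∂μ, f t ≠ 0 → p (t⁻¹ * x) := by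
  obtain ⟨h, u, hc, hs, hu, hsum, hf⟩ := l1_exists_series f
  have key : ∀ n, ∀ᵐ t ∂μ, t ∈ tsupport (h n) → p (t⁻¹ * x) := by
    intro n
    have hK : IsCompact (x⁻¹ • tsupport (h n)) := (hs n).isCompact.smul x⁻¹
    have := haar_inv_null_inter (μ := μ) (N := {y | ¬ p y}) hp hK
    have h2 := (measure_preimage_mul μ x⁻¹ ({y | ¬ p y}⁻¹ ∩ x⁻¹ • tsupport (h n))).trans this
    rw [ae_iff]
    refine measure_mono_null (fun t ht ↦ ?_) h2
    simp only [Set.mem_ofPred_eq, Classical.not_imp] at ht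
    refine ⟨?_, Set.smul_mem_smul_set ht.1⟩
    simpa using ht.2
  filter_upwards [l1_hasSum_ae u f hsum hf, ae_all_iff.2 hu, ae_all_iff.2 key] with t a b c ht
  by_contra hcon
  refine ht (a.2.unique ?_)
  have : ∀ n, u n t = 0 := fun n ↦ by
    rw [b]
    exact image_eq_zero_of_notMem_tsupport fun h ↦ hcon (c n h)
  simp only [this]
  exact hasSum_zero

theorem l1BochnerConv_ae_eq (f g : Lp ℂ 1 μ) : l1BochnerConv f g =ᵐ[μ] convFun μ f g := by
  obtain ⟨h, u, hc, hs, hu, hsum, hg⟩ := l1_exists_series g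
  obtain ⟨f', hf'⟩ := l1_exists_norm f
  choose u' hu' using fun n ↦ l1_exists_norm (u n)
  have hun : ∀ n, u' n =ᵐ[μ] fun t ↦ (‖h n t‖ : ℂ) := fun n ↦
    (hu' n).trans ((hu n).mono fun t ht ↦ by simp only [ht])
  have hnorm : ∀ n, ‖u' n‖ = ‖u n‖ := fun n ↦ by
    rw [L1.norm_eq_integral_norm, L1.norm_eq_integral_norm]
    exact integral_congr_ae ((hu' n).mono fun t ht ↦ by simp [ht])
  have hs1 : Summable fun n ↦ ‖l1BochnerConv f' (u' n)‖ := by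
    refine Summable.of_nonneg_of_le (fun _ ↦ norm_nonneg _)
      (fun n ↦ l1BochnerConv_norm_le _ _) ?_
    simp only [hnorm]
    exact hsum.mul_left _
  have hs2 : Summable fun n ↦ ‖l1BochnerConv f (u n)‖ :=
    Summable.of_nonneg_of_le (fun _ ↦ norm_nonneg _)
      (fun n ↦ l1BochnerConv_norm_le _ _) (hsum.mul_left _)
  filter_upwards [l1_hasSum_ae _ _ hs1 hs1.of_norm.hasSum,
    l1_hasSum_ae _ _ hs2 ((l1BochnerConv f).hasSum hg),
    ae_all_iff.2 fun n ↦ conv_lc f (hc n) (hs n) (hu n),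
    ae_all_iff.2 fun n ↦ conv_lc f' (g := fun t ↦ (‖h n t‖ : ℂ))
      (Complex.continuous_ofReal.comp (hc n).norm)
      ((hs n).comp_left (g := fun z : ℂ ↦ (‖z‖ : ℂ)) (by simp)) (hun n)] with x a b c d
  have hb := b.2
  simp only [c] at hb
  refine hb.unique (conv_series (fun n ↦ ?_) ?_ ?_)
  · obtain ⟨M, hM⟩ := (hs n).exists_bound_of_continuous (hc n)
    have h1 : Continuous fun t ↦ h n (t⁻¹ * x) := by fun_prop
    have h2 : HasCompactSupport fun t ↦ h n (t⁻¹ * x) :=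
      (hs n).comp_homeomorph ((Homeomorph.inv G).trans (Homeomorph.mulRight x))
    exact (L1.integrable_coeFn f).mul_bdd
      (h1.stronglyMeasurable_of_hasCompactSupport h2).aestronglyMeasurable
      (ae_of_all _ fun t ↦ hM _)
  · refine a.1.congr fun n ↦ ?_
    rw [d, convFun, integral_congr_ae
      (g := fun t ↦ ((‖f t * h n (t⁻¹ * x)‖ : ℝ) : ℂ)) (hf'.mono fun t ht ↦ by simp [ht]),
      integral_complex_ofReal, Complex.norm_real,
      Real.norm_of_nonneg (integral_nonneg fun t ↦ norm_nonneg _)]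
  · have hp : ∀ᵐ y ∂μ, HasSum (fun n ↦ h n y) (g y) := by
      filter_upwards [l1_hasSum_ae u g hsum hg, ae_all_iff.2 hu] with y a b
      simpa only [b] using a.2
    filter_upwards [l1_ae_inv f hp x] with t ht
    by_cases h0 : f t = 0
    · simp only [h0, zero_mul]
      exact hasSum_zero
    · exact (ht h0).mul_left _

theorem memLp_convFun (f g : Lp ℂ 1 μ) : MemLp (convFun μ f g) 1 μ :=
  (memLp_congr_ae (l1BochnerConv_ae_eq f g)).1 (Lp.memLp _)

lemma l1BochnerConv_assoc (f g h : Lp ℂ 1 μ) :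
    l1BochnerConv (l1BochnerConv f g) h = l1BochnerConv f (l1BochnerConv g h) := by
  have htr : ∀ t : G, DomMulAct.mk t⁻¹ • l1BochnerConv g h =
      l1BochnerConv (DomMulAct.mk t⁻¹ • g) h := by
    intro t
    let T : Lp ℂ 1 μ →L[ℂ] Lp ℂ 1 μ := LinearMap.mkContinuous
      { toFun := fun k ↦ DomMulAct.mk t⁻¹ • k
        map_add' := fun a b ↦ smul_add _ _ _
        map_smul' := fun c a ↦ smul_comm _ _ _ } 1 fun k ↦ by
          rw [one_mul]
          exact (DomMulAct.norm_smul_Lp _ _).le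
    change T (l1BochnerConv g h) = _
    rw [l1BochnerConv_apply, l1BochnerConv_apply, ← ContinuousLinearMap.integral_comp_comm _
      (l1_integrable_smul_translate (L1.integrable_coeFn g) h),
      ← integral_mul_left_eq_self _ t⁻¹]
    refine integral_congr_ae ?_
    filter_upwards [l1_translate_coe t g] with s hs
    rw [hs, map_smul]
    congr 1
    change DomMulAct.mk t⁻¹ • DomMulAct.mk (t⁻¹ * s)⁻¹ • h = _
    rw [smul_smul, ← DomMulAct.mk_mul]
    simp
  rw [l1BochnerConv_apply f (l1BochnerConv g h)]
  simp only [htr]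
  change (l1BochnerConv.flip h) (l1BochnerConv f g) = _
  rw [l1BochnerConv_apply f g, ← ContinuousLinearMap.integral_comp_comm _
    (l1_integrable_smul_translate (L1.integrable_coeFn f) g)]
  simp only [map_smul, ContinuousLinearMap.flip_apply]

/-- The underlying Banach space of the group algebra: `L¹(G)` for the Haar measure `μ`. The product
given to it below is convolution. -/
abbrev L1GroupAlgebra {G : Type*} [MeasurableSpace G] (μ : Measure G) : Type _ := Lp ℂ 1 μ

/-- The product of the group algebra is the class of the convolution of representatives. -/
noncomputable def l1Mul (f g : Lp ℂ 1 μ) : Lp ℂ 1 μ :=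
  (memLp_convFun f g).toLp (convFun μ f g)

lemma l1Mul_eq (f g : Lp ℂ 1 μ) : l1Mul f g = l1BochnerConv f g :=
  Lp.ext (((memLp_convFun f g).coeFn_toLp).trans (l1BochnerConv_ae_eq f g).symm)

/-- The group algebra `L¹(G)` as a (non-unital) normed ring under convolution. -/
noncomputable instance : NonUnitalNormedRing (L1GroupAlgebra μ) :=
  { (inferInstance : NormedAddCommGroup (L1GroupAlgebra μ)) with
    mul := fun f g ↦ l1Mul f g
    left_distrib := fun a b c ↦ by
      change l1Mul a (b + c) = l1Mul a b + l1Mul a c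
      simp only [l1Mul_eq]
      exact map_add _ _ _
    right_distrib := fun a b c ↦ by
      change l1Mul (a + b) c = l1Mul a c + l1Mul b c
      simp only [l1Mul_eq]
      rw [map_add, _root_.add_apply]
    zero_mul := fun a ↦ by
      change l1Mul 0 a = 0
      rw [l1Mul_eq, map_zero, _root_.zero_apply]
    mul_zero := fun a ↦ by
      change l1Mul a 0 = 0
      rw [l1Mul_eq, map_zero]
    mul_assoc := fun a b c ↦ by
      change l1Mul (l1Mul a b) c = l1Mul a (l1Mul b c)
      simp only [l1Mul_eq]
      exact l1BochnerConv_assoc a b c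
    norm_mul_le := fun a b ↦ by
      change ‖l1Mul a b‖ ≤ _
      rw [l1Mul_eq]
      exact l1BochnerConv_norm_le a b }

lemma l1GroupAlgebra_mul_ae_eq (f g : L1GroupAlgebra μ) : (f * g) =ᵐ[μ] convFun μ f g :=
  (memLp_convFun f g).coeFn_toLp

instance : IsScalarTower ℂ (L1GroupAlgebra μ) (L1GroupAlgebra μ) where
  smul_assoc c a b := by
    change l1Mul (c • a) b = c • l1Mul a b
    rw [l1Mul_eq, l1Mul_eq, map_smul, _root_.smul_apply]

instance : SMulCommClass ℂ (L1GroupAlgebra μ) (L1GroupAlgebra μ) where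
  smul_comm c a b := by
    change c • l1Mul a b = l1Mul a (c • b)
    rw [l1Mul_eq, l1Mul_eq, map_smul]

end L1Convolution

section ZeroProduct

variable (A : Type*) [NonUnitalNormedRing A] [NormedSpace ℂ A] [IsScalarTower ℂ A A]
  [SMulCommClass ℂ A A]

/-- The continuous bilinear functionals `(a, b) ↦ ξ (a * b)` with `ξ` in the dual of `A`. -/
def productForms : Set (A →L[ℂ] A →L[ℂ] ℂ) :=
  {ψ | ∃ ξ : A →L[ℂ] ℂ, ∀ a b : A, ψ a b = ξ (a * b)}

variable {A}

/-- The distance from `φ` to the functionals `ξ ∘ π`, in the norm of bounded bilinear forms. -/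
noncomputable def distProductForms (φ : A →L[ℂ] A →L[ℂ] ℂ) : ℝ :=
  sInf {r : ℝ | ∃ ψ ∈ productForms A, r = ‖φ - ψ‖}

/-- `|φ|_b`, the supremum of `|φ(ab, c) - φ(a, bc)|` over unit vectors. -/
noncomputable def balancedSeminorm (φ : A →L[ℂ] A →L[ℂ] ℂ) : ℝ :=
  sSup {r : ℝ | ∃ a b c : A, ‖a‖ = 1 ∧ ‖b‖ = 1 ∧ ‖c‖ = 1 ∧
    r = ‖φ (a * b) c - φ a (b * c)‖}

/-- `|φ|_zp`, the supremum of `|φ(a, b)|` over unit vectors with `ab = 0`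
(it is `0` when there are no such vectors). -/
noncomputable def zeroProductSeminorm (φ : A →L[ℂ] A →L[ℂ] ℂ) : ℝ :=
  sSup {r : ℝ | ∃ a b : A, ‖a‖ = 1 ∧ ‖b‖ = 1 ∧ a * b = 0 ∧ r = ‖φ a b‖}

variable (A)

/-- `A` is strongly zero product determined. -/
def IsStronglyZeroProductDetermined : Prop :=
  ∃ α : ℝ, ∀ φ : A →L[ℂ] A →L[ℂ] ℂ, distProductForms φ ≤ α * zeroProductSeminorm φ

/-- `A` has the strong property `𝔹`. -/
def HasStrongPropertyB : Prop :=
  ∃ β : ℝ, ∀ φ : A →L[ℂ] A →L[ℂ] ℂ, balancedSeminorm φ ≤ β * zeroProductSeminorm φ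

/-- The optimal (smallest nonnegative) constant `α_A` in the distance estimate. -/
noncomputable def zeroProductConst : ℝ :=
  sInf {α : ℝ | 0 ≤ α ∧
    ∀ φ : A →L[ℂ] A →L[ℂ] ℂ, distProductForms φ ≤ α * zeroProductSeminorm φ}

/-- The optimal (smallest nonnegative) constant `β_A` in the estimate of the strong property. -/
noncomputable def propertyBConst : ℝ :=
  sInf {β : ℝ | 0 ≤ β ∧
    ∀ φ : A →L[ℂ] A →L[ℂ] ℂ, balancedSeminorm φ ≤ β * zeroProductSeminorm φ}

end ZeroProduct

/-!
The proof rests on one estimate for the Wiener algebra of the circle, applied to the operators of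
translation by a group element.

Write `R t a = a * δ_t` and `L t b = δ_t * b`; both are isometries of `L¹(G)` and
`R t a * b = a * L t b`. For fixed `t`, `a`, `b`, the functional calculus `f ↦ f(t)` of the Wiener
algebra turns a bilinear functional `φ` into the form `(f, g) ↦ φ (a f(t)) (g(t) b)`, and `f g = 0`
forces `a f(t) * g(t) b = 0`. So the bounded function `d p q = φ (R (t ^ p) a) (L (t ^ q) b)` on
`ℤ × ℤ` is small on tensor products of functions with product zero
(`IsMultiplierAction.isSmallOnZeroProducts`).

Let `s = sin (π/10)`. The difference `d 1 (-1) - d 0 0` is the value of `d` on the function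
`exp (2πi (x - y)) - 1` of the torus. Near the diagonal, for `|x - y| ≤ 1/10`, that function agrees
with one whose coefficients have absolute sum `2 s` (`exists_arc`). What is left vanishes near the
diagonal; a partition of unity into `30` tents cuts it into pieces which are products of a function
and another supported off it, up to terms that vanish identically, and each piece is controlled by
the smallness of `d` (`norm_antidiagonal_sub_le`). With `M` the best constant in
`|φ (R t a) b - φ a (L t b)| ≤ M ‖a‖ ‖b‖`, the outcome is `M ≤ 2 s M + 240 (1 + s) |φ|_zp`. As
`2 s < 1`, this gives `M ≤ 240 (1 + s) / (1 - 2 s) |φ|_zp` (`IsMultiplierAction.defect_le`), and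
`240 ≤ 60 √27`.

Integrating against `f ∈ L¹(G)`, and using `a * f = ∫ f(t) R t a dt`
(`l1RightBochnerConv_eq`), one gets the strong property `𝔹` with the constant of the theorem.
Finally `L¹(G)` has a left approximate identity `e` of norm at most one, and for a weak-* limit point `ξ` of
the functionals `φ(e, ·)` the form `(a, b) ↦ ξ (a * b)` is within `|φ|_b` of `φ`
(`distProductForms_le_balancedSeminorm`), so that `α ≤ β`.
-/

/-! ### Absolutely convergent Fourier series -/

/-- `f` is the sum of the absolutely convergent Fourier series with coefficients `u`; that is, `f`
lies in the Wiener algebra of the circle `ℝ / ℤ`, and its norm there is `∑' n, ‖u n‖`. -/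
structure HasAbsFourierSeries (u : ℤ → ℂ) (f : UnitAddCircle → ℂ) : Prop where
  summable : Summable fun n ↦ ‖u n‖
  hasSum : ∀ x, HasSum (fun n ↦ u n * fourier n x) (f x)

namespace HasAbsFourierSeries

variable {u v : ℤ → ℂ} {f g : UnitAddCircle → ℂ}

lemma of_summable (hu : Summable fun n ↦ ‖u n‖) :
    HasAbsFourierSeries u fun x ↦ ∑' n, u n * fourier n x := by
  refine ⟨hu, fun x ↦ Summable.hasSum (Summable.of_norm ?_)⟩
  simpa only [norm_mul, fourier_apply, Circle.norm_coe, mul_one] using hu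

lemma congr_fun (hu : HasAbsFourierSeries u f) (h : ∀ x, f x = g x) :
    HasAbsFourierSeries u g := by
  rwa [← funext h]

/-- The Fourier coefficients are determined by the function. -/
lemma eq_zero (hu : HasAbsFourierSeries u fun _ ↦ 0) (k : ℤ) : u k = 0 := by
  have hc : ∀ n, ∫ x : UnitAddCircle, u n * fourier n x * fourier (-k) x ∂AddCircle.haarAddCircle
      = if n = k then u n else 0 := by
    intro n
    have h1 := congrFun (fourierCoeff_fourier (T := 1) n) k
    rw [fourierCoeff] at h1
    simp only [smul_eq_mul] at h1
    simp only [mul_assoc]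
    rw [MeasureTheory.integral_const_mul]
    simp only [mul_comm (fourier n _)]
    rw [h1, Pi.single_apply]
    by_cases hnk : n = k
    · simp [hnk]
    · simp [hnk, Ne.symm hnk]
  have hint : ∀ n, MeasureTheory.Integrable
      (fun x : UnitAddCircle ↦ u n * fourier n x * fourier (-k) x) AddCircle.haarAddCircle := by
    intro n
    refine Continuous.integrable_of_hasCompactSupport ?_ (HasCompactSupport.of_compactSpace _)
    exact (continuous_const.mul (map_continuous _)).mul (map_continuous _)
  have hs := MeasureTheory.hasSum_integral_of_summable_integral_norm hint (by
    simp only [norm_mul, fourier_apply, Circle.norm_coe, mul_one]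
    simpa using hu.summable)
  have hz : ∀ x : UnitAddCircle, ∑' n, u n * fourier n x * fourier (-k) x = 0 := fun x ↦ by
    rw [tsum_mul_right, (hu.hasSum x).tsum_eq, zero_mul]
  simp only [hc, hz, MeasureTheory.integral_zero] at hs
  exact (hasSum_ite_eq k (u k)).unique (by convert! hs using 2 with n; split_ifs with h <;> simp [h])

lemma add (hu : HasAbsFourierSeries u f) (hv : HasAbsFourierSeries v g) :
    HasAbsFourierSeries (fun n ↦ u n + v n) fun x ↦ f x + g x := by
  refine ⟨Summable.of_nonneg_of_le (fun _ ↦ norm_nonneg _) (fun n ↦ norm_add_le _ _)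
    (hu.summable.add hv.summable), fun x ↦ ?_⟩
  simpa only [add_mul] using (hu.hasSum x).add (hv.hasSum x)

lemma sub (hu : HasAbsFourierSeries u f) (hv : HasAbsFourierSeries v g) :
    HasAbsFourierSeries (fun n ↦ u n - v n) fun x ↦ f x - g x := by
  refine ⟨Summable.of_nonneg_of_le (fun _ ↦ norm_nonneg _) (fun n ↦ norm_sub_le _ _)
    (hu.summable.add hv.summable), fun x ↦ ?_⟩
  simpa only [sub_mul] using (hu.hasSum x).sub (hv.hasSum x)

lemma mul_const (hu : HasAbsFourierSeries u f) (c : ℂ) :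
    HasAbsFourierSeries (fun n ↦ u n * c) fun x ↦ f x * c := by
  refine ⟨?_, fun x ↦ ?_⟩
  · simpa only [norm_mul] using hu.summable.mul_right _
  · simpa only [mul_right_comm] using (hu.hasSum x).mul_right c

lemma single (m : ℤ) : HasAbsFourierSeries (Pi.single m 1) fun x ↦ fourier m x := by
  have h : ∀ n, n ≠ m → (Pi.single m 1 : ℤ → ℂ) n = 0 := fun n hn ↦ by simp [hn]
  refine ⟨summable_of_ne_finset_zero (s := {m}) fun n hn ↦ ?_, fun x ↦ ?_⟩
  · simp [h n (by simpa using hn)]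
  · have h2 := hasSum_single (f := fun n ↦ (Pi.single m 1 : ℤ → ℂ) n * fourier n x) m
      fun n hn ↦ by rw [h n hn, zero_mul]
    simpa only [Pi.single_eq_same, one_mul] using h2

/-- Multiplication by a character shifts the coefficients. -/
lemma modulate (hu : HasAbsFourierSeries u f) (m : ℤ) :
    HasAbsFourierSeries (fun n ↦ u (n - m)) fun x ↦ fourier m x * f x := by
  refine ⟨(Equiv.subRight m).summable_iff.2 hu.summable, fun x ↦ ?_⟩
  have := (Equiv.subRight m).hasSum_iff.2 ((hu.hasSum x).mul_left (fourier m x))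
  refine this.congr_fun fun n ↦ ?_
  have e : (fourier n x : ℂ) = fourier m x * fourier (n - m) x := by
    rw [← fourier_add, add_sub_cancel]
  simp only [Function.comp_apply, Equiv.subRight_apply]
  rw [e]
  ring

/-- Translation multiplies the coefficients by a character. -/
lemma translate (hu : HasAbsFourierSeries u f) (y : UnitAddCircle) :
    HasAbsFourierSeries (fun n ↦ u n * fourier (-n) y) fun x ↦ f (x - y) := by
  refine ⟨?_, fun x ↦ (hu.hasSum (x - y)).congr_fun fun n ↦ ?_⟩
  · simpa only [norm_mul, fourier_apply, Circle.norm_coe, mul_one] using hu.summable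
  · simp only [fourier_apply, smul_sub, sub_eq_add_neg (n • x), AddCircle.toCircle_add,
      Circle.coe_mul, neg_smul]
    ring

/-- The change of variables `(k, n) ↦ (n, k - n)` that turns a double sum into a sum of
convolutions. -/
def convEquiv : ℤ × ℤ ≃ ℤ × ℤ where
  toFun p := (p.2, p.1 - p.2)
  invFun p := (p.1 + p.2, p.1)
  left_inv p := by ext <;> simp
  right_inv p := by ext <;> simp

lemma summable_prod (hu : HasAbsFourierSeries u f) (hv : HasAbsFourierSeries v g) :
    Summable fun p : ℤ × ℤ ↦ ‖u p.2 * v (p.1 - p.2)‖ := by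
  have h : Summable fun p : ℤ × ℤ ↦ ‖u p.1 * v p.2‖ := by
    simpa only [norm_mul] using hu.summable.mul_of_nonneg hv.summable (fun _ ↦ norm_nonneg _)
      fun _ ↦ norm_nonneg _
  exact convEquiv.summable_iff.2 h

/-- Cauchy product over `ℤ`, weighted by a character `e` of `ℤ`. -/
lemma _root_.hasSum_convolution_mul {u v e : ℤ → ℂ} {a b : ℂ} (he : ∀ m n, e (m + n) = e m * e n)
    (hue : Summable fun n ↦ ‖u n * e n‖) (hve : Summable fun n ↦ ‖v n * e n‖)
    (hk : ∀ k, Summable fun n ↦ ‖u n * v (k - n)‖) (ha : HasSum (fun n ↦ u n * e n) a)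
    (hb : HasSum (fun n ↦ v n * e n) b) :
    HasSum (fun k ↦ (∑' n, u n * v (k - n)) * e k) (a * b) := by
  have h1 := (summable_mul_of_summable_norm hue hve).hasSum
  rw [← tsum_mul_tsum_of_summable_norm hue hve, ha.tsum_eq, hb.tsum_eq] at h1
  have h2 : HasSum (fun p : ℤ × ℤ ↦ u p.2 * v (p.1 - p.2) * e p.1) (a * b) := by
    refine (convEquiv.hasSum_iff.2 h1).congr_fun fun p ↦ ?_
    have h := he p.2 (p.1 - p.2)
    rw [add_sub_cancel] at h
    simp only [convEquiv, Function.comp_apply, Equiv.coe_fn_mk]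
    rw [h]
    ring
  exact h2.prod_fiberwise fun k ↦ (Summable.of_norm (hk k)).hasSum.mul_right (e k)

/-- The coefficients of a product are given by convolution. -/
lemma mul (hu : HasAbsFourierSeries u f) (hv : HasAbsFourierSeries v g) :
    HasAbsFourierSeries (fun k ↦ ∑' n, u n * v (k - n)) fun x ↦ f x * g x := by
  have hs := hu.summable_prod hv
  have hk : ∀ k, Summable fun n ↦ ‖u n * v (k - n)‖ := fun k ↦ hs.prod_factor k
  have hs' : Summable fun k ↦ ∑' n, ‖u n * v (k - n)‖ := hs.prod
  refine ⟨hs'.of_nonneg_of_le (fun _ ↦ norm_nonneg _)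
    fun k ↦ norm_tsum_le_tsum_norm (hk k), fun x ↦ ?_⟩
  have hn : ∀ {w : ℤ → ℂ}, (Summable fun n ↦ ‖w n‖) → Summable fun n ↦ ‖w n * fourier n x‖ :=
    fun h ↦ by simpa only [norm_mul, fourier_apply, Circle.norm_coe, mul_one] using h
  exact hasSum_convolution_mul (e := fun n ↦ fourier n x) (fun _ _ ↦ fourier_add) (hn hu.summable)
    (hn hv.summable) hk (hu.hasSum x) (hv.hasSum x)

/-- If `h (x - y) * f x * g y` vanishes identically, then so do its double Fourier coefficients. -/
lemma tsum_antidiagonal_eq_zero {r : ℤ → ℂ} {h : UnitAddCircle → ℂ} (hr : HasAbsFourierSeries r h)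
    (hu : HasAbsFourierSeries u f) (hv : HasAbsFourierSeries v g)
    (h0 : ∀ x y, h (x - y) * f x * g y = 0) (p q : ℤ) :
    ∑' n, r n * u (p - n) * v (q + n) = 0 := by
  -- The coefficient of order `p` in the variable `x`, as a function of `y`.
  have h1 : ∀ y, (∑' n, r n * fourier (-n) y * u (p - n)) * g y = 0 := fun y ↦
    ((((hr.translate y).mul hu).mul_const (g y)).congr_fun fun x ↦ h0 x y).eq_zero p
  -- The coefficient of order `q` of that function.
  have hs : Summable fun n ↦ ‖r (-n) * u (p + n)‖ := by
    have := (Equiv.neg ℤ).summable_iff.2 ((hr.summable_prod hu).prod_factor p)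
    simpa only [Function.comp_def, Equiv.neg_apply, sub_neg_eq_add] using this
  have h2 := (((of_summable hs).mul hv).congr_fun (g := fun _ ↦ 0) fun y ↦ ?_).eq_zero q
  · rw [← (Equiv.neg ℤ).tsum_eq]
    simpa only [Equiv.neg_apply, sub_neg_eq_add, ← sub_eq_add_neg] using h2
  · rw [← h1 y, ← (Equiv.neg ℤ).tsum_eq]
    simp only [Equiv.neg_apply, neg_neg, ← sub_eq_add_neg, mul_right_comm]

end HasAbsFourierSeries

/-- If `h (x - y) * f x * g y` vanishes identically, then every bounded function `d` on the dual
group `ℤ × ℤ` of the torus annihilates it. -/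
lemma tsum_shifted_pairing_eq_zero {r u v : ℤ → ℂ} {h f g : UnitAddCircle → ℂ}
    (hr : HasAbsFourierSeries r h) (hu : HasAbsFourierSeries u f) (hv : HasAbsFourierSeries v g)
    (h0 : ∀ x y, h (x - y) * f x * g y = 0) {d : ℤ → ℤ → ℂ} {B : ℝ} (hd : ∀ p q, ‖d p q‖ ≤ B) :
    ∑' n, r n * ∑' z : ℤ × ℤ, u z.1 * v z.2 * d (n + z.1) (z.2 - n) = 0 := by
  let F : ℤ × (ℤ × ℤ) → ℂ := fun z ↦ r z.1 * (u z.2.1 * v z.2.2 * d (z.1 + z.2.1) (z.2.2 - z.1))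
  let e : ℤ × (ℤ × ℤ) ≃ ℤ × (ℤ × ℤ) :=
    { toFun := fun z ↦ (z.1, z.2.1 - z.1, z.2.2 + z.1)
      invFun := fun z ↦ (z.1, z.2.1 + z.1, z.2.2 - z.1)
      left_inv := fun z ↦ by simp
      right_inv := fun z ↦ by simp }
  have hF : Summable F := by
    have h1 : Summable fun z : ℤ × ℤ ↦ ‖u z.1‖ * ‖v z.2‖ :=
      hu.summable.mul_of_nonneg hv.summable (fun _ ↦ norm_nonneg _) fun _ ↦ norm_nonneg _
    have h2 : Summable fun z : ℤ × (ℤ × ℤ) ↦ ‖r z.1‖ * (‖u z.2.1‖ * ‖v z.2.2‖) :=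
      hr.summable.mul_of_nonneg h1 (fun _ ↦ norm_nonneg _)
        fun _ ↦ mul_nonneg (norm_nonneg _) (norm_nonneg _)
    refine Summable.of_norm_bounded (h2.mul_right B) fun z ↦ ?_
    simp only [F, norm_mul, mul_assoc]
    gcongr
    exact hd _ _
  have hFe := e.summable_iff.2 hF
  calc ∑' n, r n * ∑' z : ℤ × ℤ, u z.1 * v z.2 * d (n + z.1) (z.2 - n)
      = ∑' n, ∑' z, F (n, z) := by simp only [F, tsum_mul_left]
    _ = ∑' z, F z := hF.tsum_prod.symm
    _ = ∑' z, (F ∘ e) z := (e.tsum_eq F).symm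
    _ = ∑' z : ℤ × ℤ, ∑' n, (F ∘ e) (n, z) := by
      rw [hFe.tsum_prod]
      exact (Summable.tsum_comm (f := fun n z ↦ (F ∘ e) (n, z)) hFe).symm
    _ = ∑' z : ℤ × ℤ, 0 := by
      refine tsum_congr fun z ↦ ?_
      have := hr.tsum_antidiagonal_eq_zero hu hv h0 z.1 z.2
      rw [← zero_mul (d z.1 z.2), ← this, ← tsum_mul_right]
      refine tsum_congr fun n ↦ ?_
      simp only [F, e, Function.comp_apply, Equiv.coe_fn_mk, add_sub_cancel, add_sub_cancel_right]
      ring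
    _ = 0 := tsum_zero

/-! ### Tents and an arc function -/

open Real in
lemma hasSum_fourier_div_sq {y : ℝ} (hy : |y| ≤ 1) :
    HasSum (fun n : ℤ ↦ 1 / (n : ℂ) ^ 2 * fourier n (y : UnitAddCircle))
      ((2 * π ^ 2 * (y ^ 2 - |y| + 6⁻¹) : ℝ) : ℂ) := by
  have key : ∀ {z : ℝ}, 0 ≤ z → z ≤ 1 →
      HasSum (fun n : ℤ ↦ 1 / (n : ℂ) ^ 2 * fourier n (z : UnitAddCircle))
        ((2 * π ^ 2 * (z ^ 2 - z + 6⁻¹) : ℝ) : ℂ) := by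
    intro z h0 h1
    convert! hasSum_one_div_pow_mul_fourier_mul_bernoulliFun le_rfl ⟨h0, h1⟩ using 1
    rw [bernoulliFun_two, mul_pow, mul_pow, Complex.I_sq]
    push_cast [Nat.factorial]
    ring
  rcases le_total 0 y with h | h
  · rw [abs_of_nonneg h] at hy ⊢
    exact key h hy
  · rw [abs_of_nonpos h] at hy ⊢
    have h1 := (Equiv.neg ℤ).hasSum_iff.2 (key (neg_nonneg.2 h) hy)
    convert! h1 using 1
    · ext n
      simp only [Function.comp_apply, Equiv.neg_apply, fourier_coe_apply]
      push_cast
      rw [neg_sq]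
      congr 3
      ring
    · rw [neg_sq]

/-- The Fourier coefficients of the tent of height `1` and half-width `w`; they are nonnegative. -/
noncomputable def tentCoeff (w : ℝ) (n : ℤ) : ℝ :=
  (if n = 0 then w else 0) + (4 * Real.pi ^ 2 * w)⁻¹ * ((2 - 2 * Real.cos (2 * Real.pi * n * w)) / n ^ 2)

lemma tentCoeff_nonneg {w : ℝ} (hw : 0 < w) (n : ℤ) : 0 ≤ tentCoeff w n := by
  have h1 := Real.cos_le_one (2 * Real.pi * n * w)
  have h2 : 0 ≤ if n = 0 then w else 0 := by split_ifs <;> simp [hw.le]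
  have h3 : 0 ≤ (2 - 2 * Real.cos (2 * Real.pi * n * w)) / (n : ℝ) ^ 2 :=
    div_nonneg (by linarith) (sq_nonneg _)
  unfold tentCoeff
  positivity

lemma fourier_add_fourier_neg (n : ℤ) (w : ℝ) :
    (fourier n (w : UnitAddCircle) : ℂ) + fourier n ((-w : ℝ) : UnitAddCircle) =
      ((2 * Real.cos (2 * Real.pi * n * w) : ℝ) : ℂ) := by
  rw [fourier_coe_apply, fourier_coe_apply]
  push_cast
  rw [Complex.two_cos]
  congr 2 <;> ring

lemma fourier_coe_add (n : ℤ) (a b : ℝ) : (fourier n ((a + b : ℝ) : UnitAddCircle) : ℂ) =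
    fourier n (a : UnitAddCircle) * fourier n (b : UnitAddCircle) := by
  simp only [AddCircle.coe_add, fourier_apply, smul_add, AddCircle.toCircle_add, Circle.coe_mul]

lemma hasSum_tentCoeff {w : ℝ} (hw : 0 < w) (hw' : w ≤ 1 / 2) {a : ℝ} (ha : |a| ≤ 1 / 2) :
    HasSum (fun n : ℤ ↦ (tentCoeff w n : ℂ) * fourier n (a : UnitAddCircle))
      (((|a + w| + |a - w| - 2 * |a|) / (2 * w) : ℝ) : ℂ) := by
  have ha' := abs_le.1 ha
  have h1 := hasSum_fourier_div_sq (y := a) (by linarith)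
  have h2 := hasSum_fourier_div_sq (y := a + w) (abs_le.2 ⟨by linarith, by linarith⟩)
  have h3 := hasSum_fourier_div_sq (y := a + -w) (abs_le.2 ⟨by linarith, by linarith⟩)
  have h4 := hasSum_ite_eq (0 : ℤ) (w : ℂ)
  convert! h4.add (((h1.mul_left 2).sub (h2.add h3)).mul_left
    (((4 * Real.pi ^ 2 * w)⁻¹ : ℝ) : ℂ)) using 1
  · ext n
    rw [tentCoeff, fourier_coe_add, fourier_coe_add]
    have h5 := fourier_add_fourier_neg n w
    push_cast at h5 ⊢
    rw [← h5]
    by_cases hn : n = 0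
    · simp [hn]
    · simp only [hn, if_false, Complex.ofReal_zero]
      ring
  · have h6 : Real.pi ≠ 0 := Real.pi_ne_zero
    have h7 : w ≠ 0 := hw.ne'
    rw [← sub_eq_add_neg a w]
    norm_cast
    have e1 := sq_abs a
    field_simp
    ring

open Real in
/-- The sum of the series is the tent `max (1 - |a| / w) 0`; since the coefficients are nonnegative,
their absolute sum is its value at `0`. -/
lemma exists_tent {w : ℝ} (hw : 0 < w) (hw' : w ≤ 1 / 2) :
    ∃ f : UnitAddCircle → ℂ, HasAbsFourierSeries (fun n ↦ (tentCoeff w n : ℂ)) f ∧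
      (∀ a : ℝ, |a| ≤ 1 / 2 → f a = (((|a + w| + |a - w| - 2 * |a|) / (2 * w) : ℝ) : ℂ)) ∧
      ∑' n, ‖(tentCoeff w n : ℂ)‖ = 1 := by
  have h0 := hasSum_tentCoeff hw hw' (a := 0) (by simp)
  have hn : ∀ n, ‖(tentCoeff w n : ℂ)‖ = tentCoeff w n := fun n ↦ by
    rw [Complex.norm_real, Real.norm_of_nonneg (tentCoeff_nonneg hw n)]
  have h1 : HasSum (fun n ↦ ‖(tentCoeff w n : ℂ)‖) 1 := by
    simp only [hn]
    rw [← Complex.hasSum_ofReal]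
    convert! h0 using 1
    · ext n
      simp
    · simp only [zero_add, zero_sub, abs_neg, abs_zero, mul_zero, sub_zero, abs_of_pos hw]
      rw [← two_mul, div_self (by positivity)]
  refine ⟨_, HasAbsFourierSeries.of_summable h1.summable, fun a ha ↦ ?_, h1.tsum_eq⟩
  exact (hasSum_tentCoeff hw hw' ha).tsum_eq

/-- The translates of the tent of half-width `1 / N` by the multiples of `1 / N` form a partition of
unity. -/
lemma sum_tentCoeff_translate {N : ℕ} (hN : N ≠ 0) (n : ℤ) :
    ∑ j ∈ Finset.range N, (tentCoeff (1 / N) n : ℂ) *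
      fourier (-n) (((j / N : ℝ)) : UnitAddCircle) = if n = 0 then 1 else 0 := by
  have hN' : (N : ℂ) ≠ 0 := Nat.cast_ne_zero.2 hN
  set z : ℂ := fourier (-n) (((1 / N : ℝ)) : UnitAddCircle) with hz
  have hzj : ∀ j : ℕ, (fourier (-n) (((j / N : ℝ)) : UnitAddCircle) : ℂ) = z ^ j := by
    intro j
    rw [hz, fourier_coe_apply, fourier_coe_apply, ← Complex.exp_nat_mul]
    congr 1
    push_cast
    ring
  rw [← Finset.mul_sum]
  simp only [hzj]
  by_cases hn : n = 0
  · have : z = 1 := by simp [hz, hn]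
    simp [this, hn, tentCoeff, hN']
  rw [if_neg hn]
  by_cases hz1 : z = 1
  · -- Only the constant term has frequency divisible by `N`.
    have h1 := fourier_add_fourier_neg (-n) (1 / N)
    have h2 : (fourier (-n) ((-(1 / N : ℝ) : ℝ) : UnitAddCircle) : ℂ) = 1 := by
      have := fourier_coe_add (-n) (1 / N) (-(1 / N))
      rw [add_neg_cancel, ← hz, hz1, one_mul] at this
      rw [← this]
      simp
    rw [← hz, hz1, h2] at h1
    have h3 : (2 : ℝ) * Real.cos (2 * Real.pi * n * (1 / N)) = 2 := by
      have : ((2 * Real.cos (2 * Real.pi * (-n : ℤ) * (1 / N)) : ℝ) : ℂ) = ((2 : ℝ) : ℂ) := by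
        rw [← h1]; norm_num
      have := Complex.ofReal_injective this
      rwa [Int.cast_neg, mul_neg, neg_mul, Real.cos_neg] at this
    rw [tentCoeff, if_neg hn, h3]
    simp
  · have h1 : z ^ N = 1 := by
      rw [← hzj, div_self (Nat.cast_ne_zero.2 hN), fourier_coe_apply]
      rw [Complex.exp_eq_one_iff]
      exact ⟨-n, by push_cast; ring⟩
    rw [geom_sum_eq hz1, h1, sub_self, zero_div, mul_zero]

/-- The Fourier coefficients of the `1`-periodic function that equals
`exp (-2πi (2/5) x) - exp (-2πi (3/5) x)` for `|x| ≤ 1/2`. -/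
noncomputable def arcCoeff (k : ℤ) : ℝ :=
  (-1) ^ k * (Real.sin (2 * Real.pi / 5) / Real.pi * (5 / ((5 * k + 2) * (5 * k + 3))))

open Real in
lemma integral_exp_period {α : ℝ} (hα : α ≠ 0) :
    ∫ x in (-(1 / 2 : ℝ))..(1 / 2), Complex.exp (-2 * π * Complex.I * α * x) =
      ((sin (π * α) / (π * α) : ℝ) : ℂ) := by
  have hα' : (α : ℂ) ≠ 0 := Complex.ofReal_ne_zero.2 hα
  have hπ : (π : ℂ) ≠ 0 := Complex.ofReal_ne_zero.2 pi_ne_zero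
  have hI := Complex.I_ne_zero
  rw [integral_exp_mul_complex (by simp [hα', hI])]
  push_cast
  rw [Complex.sin]
  have e1 : -2 * π * Complex.I * α * (1 / 2) = -(π * α) * Complex.I := by ring
  have e2 : -2 * π * Complex.I * α * -(1 / 2) = (π * α) * Complex.I := by ring
  rw [e1, e2]
  field_simp
  rw [Complex.I_sq]
  ring

open Real in
lemma summable_arcCoeff : Summable fun k : ℤ ↦ ‖(arcCoeff k : ℂ)‖ := by
  have h : Summable fun k : ℤ ↦ (1 / (k : ℝ) ^ 2) := by
    simpa using Real.summable_one_div_int_pow.2 (le_refl 2)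
  refine Summable.of_norm_bounded_eventually (g := fun k : ℤ ↦
    |sin (2 * π / 5) / π| * 5 * (1 / (k : ℝ) ^ 2)) (h.mul_left _) ?_
  filter_upwards [(Set.finite_singleton (0 : ℤ)).compl_mem_cofinite] with k hk
  have hk1 : (1 : ℝ) ≤ (k : ℝ) ^ 2 := by
    have : 0 < k ^ 2 := sq_pos_of_ne_zero hk
    exact_mod_cast this
  have h1 : (k : ℝ) ^ 2 ≤ (5 * k + 2) * (5 * k + 3) := by nlinarith [sq_nonneg ((k : ℝ) + 1)]
  rw [norm_norm, Complex.norm_real, arcCoeff, norm_mul, norm_zpow, norm_neg, norm_one, one_zpow,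
    one_mul, norm_mul, mul_assoc, Real.norm_eq_abs, norm_div, Real.norm_of_nonneg (by norm_num),
    Real.norm_of_nonneg ((sq_nonneg (k : ℝ)).trans h1), mul_one_div]
  gcongr

/-- The values at the two ends of a period agree, so the periodic function is continuous. -/
lemma arc_endpoint : Complex.exp (-2 * Real.pi * Complex.I * (2 / 5) * (-(1 / 2) : ℝ)) -
    Complex.exp (-2 * Real.pi * Complex.I * (3 / 5) * (-(1 / 2) : ℝ)) =
      ((2 * Real.sin (Real.pi / 10) : ℝ) : ℂ) ∧
    Complex.exp (-2 * Real.pi * Complex.I * (2 / 5) * (1 / 2 : ℝ)) -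
    Complex.exp (-2 * Real.pi * Complex.I * (3 / 5) * (1 / 2 : ℝ)) =
      ((2 * Real.sin (Real.pi / 10) : ℝ) : ℂ) := by
  have e0 : Real.sin (Real.pi / 10) = Real.cos (2 * Real.pi / 5) := by
    rw [← Real.cos_pi_div_two_sub]
    congr 1
    ring
  have h0 : ((2 * Real.sin (Real.pi / 10) : ℝ) : ℂ) =
      Complex.exp (2 * Real.pi / 5 * Complex.I) + Complex.exp (-(2 * Real.pi / 5) * Complex.I) := by
    rw [e0]
    push_cast
    rw [Complex.two_cos]
  have hp : Complex.exp (-(Real.pi * Complex.I)) = -1 := by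
    rw [Complex.exp_neg, Complex.exp_pi_mul_I]; norm_num
  rw [h0]
  push_cast
  constructor
  · rw [show -2 * (Real.pi : ℂ) * Complex.I * (3 / 5) * -(1 / 2) =
        -(2 * Real.pi / 5) * Complex.I + Real.pi * Complex.I by ring, Complex.exp_add,
      Complex.exp_pi_mul_I, mul_neg_one, sub_neg_eq_add]
    congr 2
    ring
  · rw [show -2 * (Real.pi : ℂ) * Complex.I * (3 / 5) * (1 / 2) =
        2 * Real.pi / 5 * Complex.I + -(Real.pi * Complex.I) by ring, Complex.exp_add,
      hp, mul_neg_one, sub_neg_eq_add, add_comm]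
    congr 2
    ring

open Real in
lemma hasSum_arcCoeff {x : ℝ} (hx : |x| ≤ 1 / 2) :
    HasSum (fun k : ℤ ↦ (arcCoeff k : ℂ) * fourier k (x : UnitAddCircle))
      (Complex.exp (-2 * π * Complex.I * (2 / 5) * x) -
        Complex.exp (-2 * π * Complex.I * (3 / 5) * x)) := by
  set g : ℝ → ℂ := fun x ↦ Complex.exp (-2 * π * Complex.I * (2 / 5) * x) -
        Complex.exp (-2 * π * Complex.I * (3 / 5) * x) with hg
  have hgc : Continuous g := by fun_prop
  have hper : g (-(1 / 2)) = g (-(1 / 2) + 1) := by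
    rw [show (-(1 / 2) + 1 : ℝ) = 1 / 2 by norm_num]
    exact arc_endpoint.1.trans arc_endpoint.2.symm
  let F : C(UnitAddCircle, ℂ) :=
    ⟨AddCircle.liftIco 1 (-(1 / 2)) g, AddCircle.liftIco_continuous hper hgc.continuousOn⟩
  have hF0 : ∀ y ∈ Set.Ico (-(1 / 2) : ℝ) (-(1 / 2) + 1), F (y : UnitAddCircle) = g y :=
    fun y hy ↦ AddCircle.liftIco_coe_apply (f := g) hy
  have hF : ∀ y : ℝ, |y| ≤ 1 / 2 → F (y : UnitAddCircle) = g y := by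
    intro y hy
    have hy' := abs_le.1 hy
    rcases hy'.2.lt_or_eq with h | h
    · exact hF0 y ⟨hy'.1, by linarith⟩
    · have h1 : ((y : ℝ) : UnitAddCircle) = ((-(1 / 2) : ℝ) : UnitAddCircle) := by
        rw [h, ← AddCircle.coe_add_period 1 (-(1 / 2) : ℝ)]
        norm_num
      rw [h1, h, show g (1 / 2) = g (-(1 / 2)) by rw [hper]; norm_num]
      exact hF0 _ ⟨le_rfl, by norm_num⟩
  have hcoeff : fourierCoeff F = fun k ↦ (arcCoeff k : ℂ) := by
    ext k
    rw [fourierCoeff_eq_intervalIntegral _ _ (-(1 / 2)), div_one, one_smul,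
      show (-(1 / 2) + 1 : ℝ) = 1 / 2 by norm_num]
    have h2 : (k + 2 / 5 : ℝ) ≠ 0 := fun h ↦ by
      have : ((5 * k + 2 : ℤ) : ℝ) = 0 := by push_cast; linarith
      have := Int.cast_eq_zero.1 this
      omega
    have h3 : (k + 3 / 5 : ℝ) ≠ 0 := fun h ↦ by
      have : ((5 * k + 3 : ℤ) : ℝ) = 0 := by push_cast; linarith
      have := Int.cast_eq_zero.1 this
      omega
    have e : Set.EqOn (fun y : ℝ ↦ (fourier (-k) (y : UnitAddCircle) : ℂ) • F y)
        (fun y ↦ Complex.exp (-2 * π * Complex.I * (k + 2 / 5 : ℝ) * y) -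
          Complex.exp (-2 * π * Complex.I * (k + 3 / 5 : ℝ) * y))
        (Set.uIcc (-(1 / 2)) (1 / 2)) := by
      intro y hy
      rw [Set.uIcc_of_le (by norm_num)] at hy
      simp only
      rw [hF y (abs_le.2 hy), fourier_coe_apply, smul_eq_mul, hg, mul_sub, ← Complex.exp_add,
        ← Complex.exp_add]
      congr 2 <;> push_cast <;> ring
    rw [intervalIntegral.integral_congr e, intervalIntegral.integral_sub,
      integral_exp_period h2, integral_exp_period h3]
    · norm_cast
      have s2 : sin (π * (k + 2 / 5)) = (-1) ^ k * sin (2 * π / 5) := by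
        rw [← Real.sin_add_int_mul_pi]
        congr 1
        ring
      have s3 : sin (π * (k + 3 / 5)) = (-1) ^ k * sin (2 * π / 5) := by
        rw [← Real.sin_pi_sub (2 * π / 5), ← Real.sin_add_int_mul_pi]
        congr 1
        ring
      have h2' : (5 * k + 2 : ℝ) ≠ 0 := fun h ↦ h2 (by linarith)
      have h3' : (5 * k + 3 : ℝ) ≠ 0 := fun h ↦ h3 (by linarith)
      rw [arcCoeff, s2, s3]
      field_simp
      ring
    · exact Continuous.intervalIntegrable (by fun_prop) _ _
    · exact Continuous.intervalIntegrable (by fun_prop) _ _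
  have := has_pointwise_sum_fourier_series_of_summable (f := F)
    (by rw [hcoeff]; exact summable_arcCoeff.of_norm) (x : UnitAddCircle)
  rw [hF x hx, hcoeff] at this
  simpa only [smul_eq_mul] using this

lemma tsum_norm_arcCoeff : ∑' k, ‖(arcCoeff k : ℂ)‖ = 2 * Real.sin (Real.pi / 10) := by
  -- All terms of the series at `x = 1/2` are nonnegative.
  have h := hasSum_arcCoeff (x := 1 / 2) (by norm_num [abs_of_pos])
  rw [arc_endpoint.2] at h
  have h2 : HasSum (fun k : ℤ ↦ ‖(arcCoeff k : ℂ)‖) (2 * Real.sin (Real.pi / 10)) := by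
    rw [← Complex.hasSum_ofReal]
    refine h.congr_fun fun k ↦ ?_
    have e1 : (fourier k ((1 / 2 : ℝ) : UnitAddCircle) : ℂ) = (-1) ^ k := by
      rw [fourier_coe_apply, ← Complex.exp_pi_mul_I, ← Complex.exp_int_mul]
      congr 1
      push_cast
      ring
    have hpos : 0 ≤ Real.sin (2 * Real.pi / 5) / Real.pi * (5 / ((5 * k + 2) * (5 * k + 3))) := by
      have h1 : 0 ≤ Real.sin (2 * Real.pi / 5) := Real.sin_nonneg_of_nonneg_of_le_pi
        (by positivity) (by linarith [Real.pi_pos])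
      have h2 : (0 : ℝ) ≤ (5 * k + 2) * (5 * k + 3) := by
        have : (0 : ℤ) ≤ (5 * k + 2) * (5 * k + 3) := by
          rcases le_or_gt 0 k with h | h
          · positivity
          · exact mul_nonneg_of_nonpos_of_nonpos (by omega) (by omega)
        exact_mod_cast this
      have := Real.pi_pos
      positivity
    rw [e1, Complex.norm_real, arcCoeff, norm_mul, norm_zpow, norm_neg, norm_one, one_zpow,
      one_mul, Real.norm_of_nonneg hpos]
    push_cast
    rw [mul_right_comm, ← mul_zpow]
    simp
  exact h2.tsum_eq

/-- A function agreeing with `exp (2πi y) - 1` for `|y| ≤ 1/10` whose Fourier series has absolute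
sum `2 sin (π/10)`, its value at the ends of that arc. Its frequencies are `5 k + 3`. -/
lemma exists_arc : ∃ (c : ℤ → ℂ) (f : UnitAddCircle → ℂ), HasAbsFourierSeries c f ∧
    (∀ y : ℝ, |y| ≤ 1 / 10 → f y = fourier 1 (y : UnitAddCircle) - 1) ∧
    ∑' n, ‖c n‖ = 2 * Real.sin (Real.pi / 10) := by
  have hi : Function.Injective fun k : ℤ ↦ 5 * k + 3 := fun a b h ↦ by
    simp only at h
    omega
  let c : ℤ → ℂ := Function.extend (fun k ↦ 5 * k + 3) (fun k ↦ (arcCoeff k : ℂ)) 0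
  have hc : ∀ k, c (5 * k + 3) = arcCoeff k := fun k ↦ hi.extend_apply _ _ k
  have hc0 : ∀ n, n ∉ Set.range (fun k : ℤ ↦ 5 * k + 3) → c n = 0 := fun n hn ↦
    Function.extend_apply' _ _ _ (by simpa using hn)
  have hs : HasSum (fun n ↦ ‖c n‖) (2 * Real.sin (Real.pi / 10)) := by
    rw [← hi.hasSum_iff fun n hn ↦ by rw [hc0 n hn, norm_zero]]
    simp only [Function.comp_def, hc]
    rw [← tsum_norm_arcCoeff]
    exact summable_arcCoeff.hasSum
  refine ⟨c, _, HasAbsFourierSeries.of_summable hs.summable, fun y hy ↦ ?_, hs.tsum_eq⟩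
  have h5 : |5 * y| ≤ 1 / 2 := by
    rw [abs_mul, abs_of_pos (by norm_num)]
    linarith
  have h1 := (hasSum_arcCoeff h5).mul_left (fourier 3 (y : UnitAddCircle))
  refine HasSum.tsum_eq ?_
  rw [← hi.hasSum_iff fun n hn ↦ by rw [hc0 n hn, zero_mul]]
  simp only [Function.comp_def, hc]
  convert! h1 using 1
  · ext k
    rw [fourier_coe_apply, fourier_coe_apply, fourier_coe_apply, mul_left_comm, ← Complex.exp_add]
    congr 2
    push_cast
    ring
  · rw [fourier_coe_apply, fourier_coe_apply, mul_sub, ← Complex.exp_add, ← Complex.exp_add,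
      ← Complex.exp_zero]
    congr 2 <;> push_cast <;> ring

/-! ### An estimate for bounded functions on `ℤ × ℤ` -/

/-- The pairing of the coefficients of `fourier n · f ⊗ fourier (-n) · g` with `d`, where `u`, `v`
are the coefficients of `f`, `g`. -/
noncomputable def shiftedPairing (d : ℤ → ℤ → ℂ) (u v : ℤ → ℂ) (n : ℤ) : ℂ :=
  ∑' z : ℤ × ℤ, u z.1 * v z.2 * d (n + z.1) (z.2 - n)

section Pairing

variable {d : ℤ → ℤ → ℂ} {B : ℝ}

lemma shiftedPairing_summable (hd : ∀ p q, ‖d p q‖ ≤ B) {u v : ℤ → ℂ}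
    (hu : Summable fun n ↦ ‖u n‖) (hv : Summable fun n ↦ ‖v n‖) (n : ℤ) :
    Summable fun z : ℤ × ℤ ↦ u z.1 * v z.2 * d (n + z.1) (z.2 - n) := by
  have h1 : Summable fun z : ℤ × ℤ ↦ ‖u z.1‖ * ‖v z.2‖ :=
    hu.mul_of_nonneg hv (fun _ ↦ norm_nonneg _) fun _ ↦ norm_nonneg _
  refine Summable.of_norm_bounded (h1.mul_right B) fun z ↦ ?_
  simp only [norm_mul]
  gcongr
  exact hd _ _

lemma shiftedPairing_add_right (hd : ∀ p q, ‖d p q‖ ≤ B) {u v w : ℤ → ℂ}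
    (hu : Summable fun n ↦ ‖u n‖) (hv : Summable fun n ↦ ‖v n‖) (hw : Summable fun n ↦ ‖w n‖)
    (n : ℤ) : shiftedPairing d u v n + shiftedPairing d u w n =
      shiftedPairing d u (fun k ↦ v k + w k) n := by
  unfold shiftedPairing
  rw [← (shiftedPairing_summable hd hu hv n).tsum_add (shiftedPairing_summable hd hu hw n)]
  exact tsum_congr fun z ↦ by ring

lemma shiftedPairing_sum_left (hd : ∀ p q, ‖d p q‖ ≤ B) {ι : Type*} (s : Finset ι)
    {u : ι → ℤ → ℂ} {v : ℤ → ℂ} (hu : ∀ j, Summable fun n ↦ ‖u j n‖)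
    (hv : Summable fun n ↦ ‖v n‖) (n : ℤ) : ∑ j ∈ s, shiftedPairing d (u j) v n =
      shiftedPairing d (fun k ↦ ∑ j ∈ s, u j k) v n := by
  unfold shiftedPairing
  rw [← Summable.tsum_finsetSum fun j _ ↦ shiftedPairing_summable hd (hu j) hv n]
  exact tsum_congr fun z ↦ by simp only [Finset.sum_mul]

lemma shiftedPairing_single (n : ℤ) :
    shiftedPairing d (Pi.single 0 1) (Pi.single 0 1) n = d n (-n) := by
  unfold shiftedPairing
  rw [tsum_eq_single (0, 0)]
  · simp
  · rintro ⟨p, q⟩ h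
    by_cases hp : p = 0
    · by_cases hq : q = 0
      · simp [hp, hq] at h
      · simp [hq]
    · simp [hp]

/-- `d` is small on tensor products of functions whose product vanishes. -/
def IsSmallOnZeroProducts (d : ℤ → ℤ → ℂ) (E : ℝ) : Prop :=
  ∀ ⦃u v : ℤ → ℂ⦄ ⦃f g : UnitAddCircle → ℂ⦄, HasAbsFourierSeries u f → HasAbsFourierSeries v g →
    (∀ x, f x * g x = 0) →
      ‖∑' z : ℤ × ℤ, u z.1 * v z.2 * d z.1 z.2‖ ≤ E * ((∑' n, ‖u n‖) * ∑' n, ‖v n‖)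

lemma IsSmallOnZeroProducts.norm_shiftedPairing_le {E : ℝ} (hE : IsSmallOnZeroProducts d E)
    {u v : ℤ → ℂ} {f g : UnitAddCircle → ℂ} (hu : HasAbsFourierSeries u f)
    (hv : HasAbsFourierSeries v g) (h0 : ∀ x, f x * g x = 0) (n : ℤ) :
    ‖shiftedPairing d u v n‖ ≤ E * ((∑' n, ‖u n‖) * ∑' n, ‖v n‖) := by
  have h := hE (hu.modulate n) (hv.modulate (-n)) fun x ↦ by
    rw [mul_mul_mul_comm, h0, mul_zero]
  have hsh : ∀ (w : ℤ → ℂ) (m : ℤ), ∑' k, ‖w (k - m)‖ = ∑' k, ‖w k‖ := fun w m ↦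
    (Equiv.subRight m).tsum_eq fun k ↦ ‖w k‖
  rw [hsh, hsh] at h
  refine le_of_eq_of_le (congrArg norm ?_) h
  rw [shiftedPairing, ← ((Equiv.addLeft n).prodCongr (Equiv.subRight n)).tsum_eq
    fun z : ℤ × ℤ ↦ u (z.1 - n) * v (z.2 - -n) * d z.1 z.2]
  exact tsum_congr fun z ↦ by simp

end Pairing

lemma UnitAddCircle.exists_coe_eq (z : UnitAddCircle) :
    ∃ a : ℝ, |a| ≤ 1 / 2 ∧ (a : UnitAddCircle) = z := by
  have h : z ∈ ((↑) : ℝ → UnitAddCircle) '' Set.Ico (-(1 / 2)) (-(1 / 2) + 1) := by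
    rw [AddCircle.coe_image_Ico_eq]
    trivial
  obtain ⟨a, ha, rfl⟩ := h
  exact ⟨a, abs_le.2 ⟨ha.1, by linarith [ha.2]⟩, rfl⟩

lemma norm_add_tsum_norm_le {u v : ℤ → ℂ} (hu : Summable fun n ↦ ‖u n‖)
    (hv : Summable fun n ↦ ‖v n‖) : ∑' n, ‖u n + v n‖ ≤ ∑' n, ‖u n‖ + ∑' n, ‖v n‖ := by
  rw [← hu.tsum_add hv]
  exact Summable.tsum_le_tsum (fun n ↦ norm_add_le _ _)
    (Summable.of_nonneg_of_le (fun _ ↦ norm_nonneg _) (fun n ↦ norm_add_le _ _) (hu.add hv))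
    (hu.add hv)

lemma norm_sub_tsum_norm_le {u v : ℤ → ℂ} (hu : Summable fun n ↦ ‖u n‖)
    (hv : Summable fun n ↦ ‖v n‖) : ∑' n, ‖u n - v n‖ ≤ ∑' n, ‖u n‖ + ∑' n, ‖v n‖ := by
  simpa [sub_eq_add_neg] using norm_add_tsum_norm_le hu (v := fun n ↦ -v n) (by simpa using hv)

lemma tsum_norm_single (m : ℤ) : ∑' n, ‖(Pi.single m 1 : ℤ → ℂ) n‖ = 1 := by
  rw [tsum_eq_single m fun n hn ↦ by simp [hn]]
  simp

section TentSupport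

variable {τ : UnitAddCircle → ℂ} {w : ℝ}

lemma exists_coe_of_tent_ne_zero (hw : 0 < w)
    (hτ : ∀ a : ℝ, |a| ≤ 1 / 2 → τ a = (((|a + w| + |a - w| - 2 * |a|) / (2 * w) : ℝ) : ℂ))
    {z : UnitAddCircle} (hz : τ z ≠ 0) : ∃ a : ℝ, |a| < w ∧ (a : UnitAddCircle) = z := by
  obtain ⟨a, ha, rfl⟩ := UnitAddCircle.exists_coe_eq z
  refine ⟨a, ?_, rfl⟩
  by_contra! h
  rw [hτ a ha] at hz
  refine hz ?_
  have : |a + w| + |a - w| - 2 * |a| = 0 := by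
    rcases le_total 0 a with h0 | h0
    · rw [abs_of_nonneg h0] at h ⊢
      rw [abs_of_nonneg (by linarith), abs_of_nonneg (by linarith)]
      ring
    · rw [abs_of_nonpos h0] at h ⊢
      rw [abs_of_nonpos (by linarith), abs_of_nonpos (by linarith)]
      ring
  rw [this]
  simp

/-- On the support of a tent, it and its two neighbours add up to `1`. -/
lemma tent_mul_one_sub_eq_zero (hw : 0 < w) (hw' : w ≤ 1 / 4)
    (hτ : ∀ a : ℝ, |a| ≤ 1 / 2 → τ a = (((|a + w| + |a - w| - 2 * |a|) / (2 * w) : ℝ) : ℂ))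
    (z : UnitAddCircle) : τ z * (1 - (τ (z + (w : ℝ)) + τ z + τ (z - (w : ℝ)))) = 0 := by
  by_cases hz : τ z = 0
  · rw [hz, zero_mul]
  obtain ⟨a, ha, rfl⟩ := exists_coe_of_tent_ne_zero hw hτ hz
  have ha' := abs_lt.1 ha
  rw [← AddCircle.coe_add, ← AddCircle.coe_sub, hτ a (by linarith),
    hτ (a + w) (abs_le.2 ⟨by linarith, by linarith⟩),
    hτ (a - w) (abs_le.2 ⟨by linarith, by linarith⟩)]
  refine mul_eq_zero_of_right _ ?_
  norm_cast
  rw [add_sub_cancel_right, sub_add_cancel, abs_of_nonneg (a := a + w + w) (by linarith),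
    abs_of_nonneg (a := a + w) (by linarith), abs_of_nonpos (a := a - w) (by linarith),
    abs_of_nonpos (a := a - w - w) (by linarith)]
  field_simp
  ring

end TentSupport

/-- A bounded function on `ℤ × ℤ` that is small on zero products is nearly constant on the
antidiagonal, up to a fraction `2 sin (π/10)` of its oscillation there. -/
theorem norm_antidiagonal_sub_le {d : ℤ → ℤ → ℂ} {B E M : ℝ} (hB : ∀ p q, ‖d p q‖ ≤ B)
    (hE0 : 0 ≤ E) (hE : IsSmallOnZeroProducts d E) (hM : ∀ n, ‖d n (-n) - d 0 0‖ ≤ M) :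
    ‖d 1 (-1) - d 0 0‖ ≤
      2 * Real.sin (Real.pi / 10) * M + 240 * (1 + Real.sin (Real.pi / 10)) * E := by
  set s := Real.sin (Real.pi / 10) with hs
  obtain ⟨c, f₁, hc, hf₁, hcs⟩ := exists_arc
  obtain ⟨τ, hT, hτ, hTs⟩ := exists_tent (w := 1 / 30) (by norm_num) (by norm_num)
  -- The function `exp (2πi x) - 1 - f₁` vanishes on the arc `|x| ≤ 1/10`.
  have hr := ((HasAbsFourierSeries.single 1).sub (HasAbsFourierSeries.single 0)).sub hc
  set r : ℤ → ℂ := fun n ↦ (Pi.single 1 1 : ℤ → ℂ) n - (Pi.single 0 1 : ℤ → ℂ) n - c n with hrdef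
  have hrs : ∑' n, ‖r n‖ ≤ 2 + 2 * s := by
    have h1 := norm_sub_tsum_norm_le (HasAbsFourierSeries.single 1).summable
      (HasAbsFourierSeries.single 0).summable
    have h2 := norm_sub_tsum_norm_le
      ((HasAbsFourierSeries.single 1).sub (HasAbsFourierSeries.single 0)).summable hc.summable
    rw [tsum_norm_single, tsum_norm_single] at h1
    rw [hcs] at h2
    linarith
  let δ : UnitAddCircle := ((1 / 30 : ℝ) : UnitAddCircle)
  let U : UnitAddCircle → ℤ → ℂ := fun y n ↦ (tentCoeff (1 / 30) n : ℂ) * fourier (-n) y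
  have hU : ∀ y, HasAbsFourierSeries (U y) fun x ↦ τ (x - y) := fun y ↦ hT.translate y
  have hUs : ∀ y, ∑' n, ‖U y n‖ = 1 := fun y ↦ by
    simpa only [U, norm_mul, fourier_apply, Circle.norm_coe, mul_one] using hTs
  let X : UnitAddCircle → ℤ → ℂ := fun y n ↦ U (y - δ) n + U y n + U (y + δ) n
  have hX : ∀ y, HasAbsFourierSeries (X y) _ := fun y ↦ ((hU (y - δ)).add (hU y)).add (hU (y + δ))
  let V : UnitAddCircle → ℤ → ℂ := fun y n ↦ (Pi.single 0 1 : ℤ → ℂ) n - X y n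
  have hV : ∀ y, HasAbsFourierSeries (V y) _ := fun y ↦ (HasAbsFourierSeries.single 0).sub (hX y)
  have hVs : ∀ y, ∑' n, ‖V y n‖ ≤ 4 := fun y ↦ by
    have h1 := norm_add_tsum_norm_le (hU (y - δ)).summable (hU y).summable
    have h2 := norm_add_tsum_norm_le ((hU (y - δ)).add (hU y)).summable (hU (y + δ)).summable
    have h3 := norm_sub_tsum_norm_le (HasAbsFourierSeries.single 0).summable (hX y).summable
    rw [hUs, hUs] at h1
    rw [hUs] at h2
    rw [tsum_norm_single] at h3
    linarith
  have hVbound : ∀ y n, ‖shiftedPairing d (U y) (V y) n‖ ≤ E * 4 := fun y n ↦ by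
    refine (hE.norm_shiftedPairing_le (hU y) (hV y) (fun x ↦ ?_) n).trans ?_
    · rw [fourier_zero, show x - (y - δ) = x - y + δ by abel,
        show x - (y + δ) = x - y - δ by abel]
      exact tent_mul_one_sub_eq_zero (by norm_num) (by norm_num) hτ (x - y)
    · rw [hUs, one_mul]
      exact mul_le_mul_of_nonneg_left (hVs y) hE0
  have hXzero : ∀ y, ∑' n, r n * shiftedPairing d (U y) (X y) n = 0 := fun y ↦ by
    refine tsum_shifted_pairing_eq_zero hr (hU y) (hX y) (fun x x' ↦ ?_) hB
    -- Nonvanishing factors force `x - x'` to lie within `3/30` of `0`.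
    have key : ∀ b : ℝ, |b| ≤ 1 / 30 → ∀ z : UnitAddCircle, z = x' - y + (b : ℝ) →
        (fourier 1 (x - x') - fourier 0 (x - x') - f₁ (x - x')) * τ (x - y) * τ z = 0 := by
      intro b hb z hz
      by_cases h1 : τ (x - y) = 0
      · rw [h1, mul_zero, zero_mul]
      by_cases h2 : τ z = 0
      · rw [h2, mul_zero]
      obtain ⟨a, ha, hxa⟩ := exists_coe_of_tent_ne_zero (by norm_num) hτ h1
      obtain ⟨a', ha', hza⟩ := exists_coe_of_tent_ne_zero (by norm_num) hτ h2
      have e : x - x' = ((a - a' + b : ℝ) : UnitAddCircle) := by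
        rw [AddCircle.coe_add, AddCircle.coe_sub, hxa, hza, hz]
        abel
      rw [abs_le] at hb
      rw [abs_lt] at ha ha'
      rw [e, hf₁ _ (abs_le.2 ⟨by linarith, by linarith⟩), fourier_zero]
      ring
    have k1 := key (1 / 30) (by norm_num [abs_of_pos]) (x' - (y - δ)) (by simp only [δ]; abel)
    have k2 := key 0 (by norm_num) (x' - y) (by simp)
    have k3 := key (-(1 / 30)) (by norm_num [abs_of_pos]) (x' - (y + δ))
      (by rw [AddCircle.coe_neg]; simp only [δ]; abel)
    rw [mul_add, mul_add, k1, k2, k3]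
    simp
  let y : ℕ → UnitAddCircle := fun j ↦ ((j / (30 : ℕ) : ℝ) : UnitAddCircle)
  have hsplit : ∀ n, r n * d n (-n) = ∑ j ∈ Finset.range 30,
      (r n * shiftedPairing d (U (y j)) (V (y j)) n +
        r n * shiftedPairing d (U (y j)) (X (y j)) n) := fun n ↦ by
    have h1 : ∀ j, shiftedPairing d (U (y j)) (V (y j)) n + shiftedPairing d (U (y j)) (X (y j)) n
        = shiftedPairing d (U (y j)) (Pi.single 0 1) n := fun j ↦ by
      rw [shiftedPairing_add_right hB (hU _).summable (hV _).summable (hX _).summable]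
      congr 1
      ext k
      simp [V]
    have h2 : (fun k ↦ ∑ j ∈ Finset.range 30, U (y j) k) = Pi.single 0 1 := by
      ext k
      have := sum_tentCoeff_translate (N := 30) (by norm_num) k
      rw [Pi.single_apply, ← this]
      simp [U, y]
    simp only [← mul_add, h1]
    rw [← Finset.mul_sum, shiftedPairing_sum_left hB _ (fun j ↦ (hU (y j)).summable)
      (HasAbsFourierSeries.single 0).summable, h2, shiftedPairing_single]
  have hbd : ∀ {w : ℤ → ℂ} {K : ℝ}, (∀ n, ‖w n‖ ≤ K) → Summable (fun n ↦ ‖r n * w n‖) ∧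
      ‖∑' n, r n * w n‖ ≤ (∑' n, ‖r n‖) * K := fun {w K} hw ↦ by
    have h1 : ∀ n, ‖r n * w n‖ ≤ ‖r n‖ * K := fun n ↦ by
      rw [norm_mul]
      exact mul_le_mul_of_nonneg_left (hw n) (norm_nonneg _)
    have h2 := Summable.of_nonneg_of_le (fun n ↦ norm_nonneg _) h1 (hr.summable.mul_right K)
    refine ⟨h2, (norm_tsum_le_tsum_norm h2).trans ?_⟩
    rw [← tsum_mul_right]
    exact h2.tsum_le_tsum h1 (hr.summable.mul_right K)
  have hXs : ∀ y, ∃ K, ∀ n, ‖shiftedPairing d (U y) (X y) n‖ ≤ K := fun y ↦ by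
    have h1 : Summable fun z : ℤ × ℤ ↦ ‖U y z.1‖ * ‖X y z.2‖ :=
      (hU y).summable.mul_of_nonneg (hX y).summable (fun _ ↦ norm_nonneg _) fun _ ↦ norm_nonneg _
    refine ⟨∑' z : ℤ × ℤ, ‖U y z.1‖ * ‖X y z.2‖ * B, fun n ↦
      tsum_of_norm_bounded (h1.mul_right B).hasSum fun z ↦ ?_⟩
    simp only [norm_mul]
    gcongr
    exact hB _ _
  have hrd : ‖∑' n, r n * d n (-n)‖ ≤ 240 * (1 + s) * E := by
    have e : ∑' n, r n * d n (-n) =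
        ∑ j ∈ Finset.range 30, ∑' n, r n * shiftedPairing d (U (y j)) (V (y j)) n := by
      have s1 : ∀ j, Summable fun n ↦ r n * shiftedPairing d (U (y j)) (V (y j)) n := fun j ↦
        (hbd (hVbound (y j))).1.of_norm
      have s2 : ∀ j, Summable fun n ↦ r n * shiftedPairing d (U (y j)) (X (y j)) n := fun j ↦
        (hbd (hXs (y j)).choose_spec).1.of_norm
      rw [tsum_congr hsplit, Summable.tsum_finsetSum fun j _ ↦ (s1 j).add (s2 j)]
      refine Finset.sum_congr rfl fun j _ ↦ ?_
      rw [(s1 j).tsum_add (s2 j), hXzero, add_zero]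
    rw [e]
    calc _ ≤ ∑ j ∈ Finset.range 30, (2 + 2 * s) * (E * 4) := by
          refine norm_sum_le_of_le _ fun j _ ↦ ((hbd (hVbound (y j))).2).trans ?_
          gcongr
      _ = 240 * (1 + s) * E := by
          rw [Finset.sum_const, Finset.card_range, nsmul_eq_mul]
          push_cast
          ring
  -- The coefficients `c` add up to `f₁ 0 = 0`.
  have hc0 : ∑' n, c n = 0 := by
    have h1 := hc.hasSum 0
    have h2 := hf₁ 0 (by norm_num)
    simp only [AddCircle.coe_zero, fourier_eval_zero, sub_self] at h2
    simp only [fourier_eval_zero, mul_one] at h1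
    rw [h1.tsum_eq, h2]
  have hcb : ∀ n, ‖c n * (d n (-n) - d 0 0)‖ ≤ ‖c n‖ * M := fun n ↦ by
    rw [norm_mul]
    exact mul_le_mul_of_nonneg_left (hM n) (norm_nonneg _)
  have hcd : ‖∑' n, c n * (d n (-n) - d 0 0)‖ ≤ 2 * s * M := by
    rw [← hcs]
    exact tsum_of_norm_bounded (hc.summable.hasSum.mul_right M) hcb
  have hdec : d 1 (-1) - d 0 0 = ∑' n, r n * d n (-n) + ∑' n, c n * (d n (-n) - d 0 0) := by
    have t0 : ∀ m : ℤ, HasSum (fun n ↦ (Pi.single m 1 : ℤ → ℂ) n * d n (-n)) (d m (-m)) := by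
      intro m
      have := hasSum_single (f := fun n ↦ (Pi.single m 1 : ℤ → ℂ) n * d n (-n)) m
        fun n hn ↦ by simp [hn]
      simpa using this
    have t1 : Summable fun n ↦ c n * (d n (-n) - d 0 0) :=
      Summable.of_norm_bounded (hc.summable.mul_right M) hcb
    have t2 : HasSum (fun n ↦ c n * d 0 0) 0 := by
      have := hc.summable.of_norm.hasSum.mul_right (d 0 0)
      rwa [hc0, zero_mul] at this
    have t3 := ((t0 1).sub (t0 0)).sub (t1.hasSum.add t2)
    have t4 : ∑' n, r n * d n (-n) = _ := (t3.congr_fun fun n ↦ by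
      simp only [hrdef]
      ring).tsum_eq
    rw [t4, neg_zero]
    ring
  rw [hdec]
  refine (norm_add_le _ _).trans ?_
  linarith

/-! ### Banach algebras with a group of multipliers -/

/-- A continuous bilinear map applied to two absolutely convergent series. -/
lemma ContinuousLinearMap.map_tsum₂ {X Y Z ι κ : Type*} [NormedAddCommGroup X] [NormedSpace ℂ X]
    [CompleteSpace X] [NormedAddCommGroup Y] [NormedSpace ℂ Y] [CompleteSpace Y]
    [NormedAddCommGroup Z] [NormedSpace ℂ Z] [CompleteSpace Z] (β : X →L[ℂ] Y →L[ℂ] Z)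
    {x : ι → X} {y : κ → Y} (hx : Summable fun i ↦ ‖x i‖) (hy : Summable fun j ↦ ‖y j‖) :
    Summable (fun z : ι × κ ↦ ‖β (x z.1) (y z.2)‖) ∧
      β (∑' i, x i) (∑' j, y j) = ∑' z : ι × κ, β (x z.1) (y z.2) := by
  have h1 : Summable fun z : ι × κ ↦ ‖x z.1‖ * ‖y z.2‖ :=
    hx.mul_of_nonneg hy (fun _ ↦ norm_nonneg _) fun _ ↦ norm_nonneg _
  have h2 : Summable fun z : ι × κ ↦ ‖β (x z.1) (y z.2)‖ := by
    refine Summable.of_nonneg_of_le (fun _ ↦ norm_nonneg _) (fun z ↦ ?_) (h1.mul_left ‖β‖)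
    rw [← mul_assoc]
    exact β.le_opNorm₂ _ _
  refine ⟨h2, ?_⟩
  rw [h2.of_norm.tsum_prod, β.map_tsum hx.of_norm]
  have h3 : Summable fun i ↦ β (x i) := by
    refine Summable.of_norm_bounded (hx.mul_left ‖β‖) fun i ↦ β.le_opNorm _
  change ContinuousLinearMap.apply ℂ Z (∑' j, y j) (∑' i, β (x i)) = _
  rw [ContinuousLinearMap.map_tsum _ h3]
  refine tsum_congr fun i ↦ ?_
  rw [ContinuousLinearMap.apply_apply, ContinuousLinearMap.map_tsum _ hy.of_norm]

lemma tsum_prod_eq_tsum_antidiagonal {X : Type*} [NormedAddCommGroup X] [CompleteSpace X]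
    {w : ℤ × ℤ → X} (hw : Summable w) : ∑' z, w z = ∑' k, ∑' n, w (n, k - n) := by
  have h : Summable (w ∘ HasAbsFourierSeries.convEquiv) :=
    HasAbsFourierSeries.convEquiv.summable_iff.2 hw
  rw [← HasAbsFourierSeries.convEquiv.tsum_eq w]
  exact h.tsum_prod

section Multipliers

variable {A : Type*} [NonUnitalNormedRing A] [NormedSpace ℂ A] [IsScalarTower ℂ A A]
  [SMulCommClass ℂ A A]

lemma zeroProductSeminorm_nonneg (φ : A →L[ℂ] A →L[ℂ] ℂ) : 0 ≤ zeroProductSeminorm φ := by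
  refine Real.sSup_nonneg ?_
  rintro r ⟨a, b, -, -, -, rfl⟩
  exact norm_nonneg _

lemma norm_inv_smul_self {a : A} (ha : a ≠ 0) : ‖((‖a‖⁻¹ : ℝ) : ℂ) • a‖ = 1 := by
  rw [norm_smul, Complex.norm_real, norm_inv, norm_norm, inv_mul_cancel₀ (norm_ne_zero_iff.2 ha)]

lemma norm_le_zeroProductSeminorm (φ : A →L[ℂ] A →L[ℂ] ℂ) {a b : A} (hab : a * b = 0) :
    ‖φ a b‖ ≤ zeroProductSeminorm φ * (‖a‖ * ‖b‖) := by
  by_cases ha : a = 0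
  · simp [ha]
  by_cases hb : b = 0
  · simp [hb]
  have hbdd : BddAbove {r : ℝ | ∃ a b : A, ‖a‖ = 1 ∧ ‖b‖ = 1 ∧ a * b = 0 ∧ r = ‖φ a b‖} := by
    refine ⟨‖φ‖, ?_⟩
    rintro r ⟨a, b, ha, hb, -, rfl⟩
    simpa [ha, hb] using φ.le_opNorm₂ a b
  have h := le_csSup hbdd ⟨((‖a‖⁻¹ : ℝ) : ℂ) • a, ((‖b‖⁻¹ : ℝ) : ℂ) • b, norm_inv_smul_self ha,
    norm_inv_smul_self hb, by rw [smul_mul_smul_comm, hab, smul_zero], rfl⟩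
  have ha' : 0 < ‖a‖ := norm_pos_iff.2 ha
  have hb' : 0 < ‖b‖ := norm_pos_iff.2 hb
  rw [map_smul, map_smul, smul_apply, norm_smul, norm_smul, Complex.norm_real,
    Complex.norm_real, norm_inv, norm_inv, norm_norm, norm_norm] at h
  calc ‖φ a b‖ = ‖b‖⁻¹ * (‖a‖⁻¹ * ‖φ a b‖) * (‖a‖ * ‖b‖) := by field_simp
    _ ≤ _ := by
      gcongr
      exact h

variable [CompleteSpace A] {G : Type*} [Group G]

/-- An action of a group `G` by contractive double multipliers on a Banach algebra: for the group
algebra, `L t` is convolution by the point mass at `t` on the left and `R t` on the right. -/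
structure IsMultiplierAction (R L : G → A →L[ℂ] A) : Prop where
  norm_right_le : ∀ t a, ‖R t a‖ ≤ ‖a‖
  norm_left_le : ∀ t a, ‖L t a‖ ≤ ‖a‖
  right_one : ∀ a, R 1 a = a
  left_one : ∀ a, L 1 a = a
  left_mul : ∀ s t a, L (s * t) a = L s (L t a)
  mul_comm : ∀ t a b, R t a * b = a * L t b

namespace IsMultiplierAction

variable {R L : G → A →L[ℂ] A}

/-- Functional calculus: if `f * g = 0` in the Wiener algebra, then `a f(t) * g(t) b = 0`. -/
lemma isSmallOnZeroProducts (h : IsMultiplierAction R L) (φ : A →L[ℂ] A →L[ℂ] ℂ) (t : G) (a b : A) :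
    IsSmallOnZeroProducts (fun p q ↦ φ (R (t ^ p) a) (L (t ^ q) b))
      (zeroProductSeminorm φ * (‖a‖ * ‖b‖)) := by
  intro u v f g hu hv hfg
  have hx' : ∀ p, ‖u p • R (t ^ p) a‖ ≤ ‖u p‖ * ‖a‖ := fun p ↦ by
    rw [norm_smul]
    exact mul_le_mul_of_nonneg_left (h.norm_right_le _ _) (norm_nonneg _)
  have hy' : ∀ p, ‖v p • L (t ^ p) b‖ ≤ ‖v p‖ * ‖b‖ := fun p ↦ by
    rw [norm_smul]
    exact mul_le_mul_of_nonneg_left (h.norm_left_le _ _) (norm_nonneg _)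
  have hx : Summable fun p ↦ ‖u p • R (t ^ p) a‖ :=
    Summable.of_nonneg_of_le (fun _ ↦ norm_nonneg _) hx' (hu.summable.mul_right _)
  have hy : Summable fun p ↦ ‖v p • L (t ^ p) b‖ :=
    Summable.of_nonneg_of_le (fun _ ↦ norm_nonneg _) hy' (hv.summable.mul_right _)
  have hzero : (∑' p, u p • R (t ^ p) a) * ∑' p, v p • L (t ^ p) b = 0 := by
    obtain ⟨h1, h2⟩ := ContinuousLinearMap.map_tsum₂ (ContinuousLinearMap.mul ℂ A) hx hy
    simp only [ContinuousLinearMap.mul_apply'] at h1 h2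
    rw [h2, tsum_prod_eq_tsum_antidiagonal h1.of_norm]
    have h0 : ∀ k, ∑' n, u n * v (k - n) = 0 :=
      ((hu.mul hv).congr_fun (g := fun _ ↦ 0) hfg).eq_zero
    have hk : ∀ k, Summable fun n ↦ u n * v (k - n) := fun k ↦
      ((hu.summable_prod hv).prod_factor k).of_norm
    rw [← tsum_zero (α := A) (β := ℤ)]
    refine tsum_congr fun k ↦ ?_
    have h4 := (hk k).tsum_smul_const (a * L (t ^ k) b)
    rw [h0, zero_smul] at h4
    rw [← h4]
    refine tsum_congr fun n ↦ ?_
    rw [smul_mul_smul_comm, h.mul_comm, ← h.left_mul, ← zpow_add, add_sub_cancel]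
  have hval := (ContinuousLinearMap.map_tsum₂ φ hx hy).2
  have e : ∑' z : ℤ × ℤ, u z.1 * v z.2 * φ (R (t ^ z.1) a) (L (t ^ z.2) b) =
      φ (∑' p, u p • R (t ^ p) a) (∑' p, v p • L (t ^ p) b) := by
    rw [hval]
    refine tsum_congr fun z ↦ ?_
    rw [map_smul, map_smul, smul_apply, smul_eq_mul, smul_eq_mul]
    ring
  rw [e]
  refine (norm_le_zeroProductSeminorm φ hzero).trans ?_
  have hxn : ‖∑' p, u p • R (t ^ p) a‖ ≤ (∑' n, ‖u n‖) * ‖a‖ :=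
    tsum_of_norm_bounded (hu.summable.hasSum.mul_right _) hx'
  have hyn : ‖∑' p, v p • L (t ^ p) b‖ ≤ (∑' n, ‖v n‖) * ‖b‖ :=
    tsum_of_norm_bounded (hv.summable.hasSum.mul_right _) hy'
  calc _ ≤ zeroProductSeminorm φ * (((∑' n, ‖u n‖) * ‖a‖) * ((∑' n, ‖v n‖) * ‖b‖)) := by
        have := zeroProductSeminorm_nonneg φ
        gcongr
    _ = _ := by ring

/-- A bound on the defect of `φ` with respect to the multipliers improves itself. -/
lemma defect_bound_improve (h : IsMultiplierAction R L) (φ : A →L[ℂ] A →L[ℂ] ℂ)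
    {K : ℝ} (hK : ∀ t a b, ‖φ (R t a) b - φ a (L t b)‖ ≤ K * (‖a‖ * ‖b‖)) (hK0 : 0 ≤ K) (t : G) (a b : A) :
    ‖φ (R t a) b - φ a (L t b)‖ ≤ (2 * Real.sin (Real.pi / 10) * K +
      240 * (1 + Real.sin (Real.pi / 10)) * zeroProductSeminorm φ) * (‖a‖ * ‖b‖) := by
  have hz := zeroProductSeminorm_nonneg φ
  have hinv : ∀ s x, L s⁻¹ (L s x) = x := fun s x ↦ by
    rw [← h.left_mul, inv_mul_cancel, h.left_one]
  have hinv' : ∀ s x, L s (L s⁻¹ x) = x := fun s x ↦ by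
    rw [← h.left_mul, mul_inv_cancel, h.left_one]
  have key := norm_antidiagonal_sub_le (d := fun p q ↦ φ (R (t ^ p) a) (L (t ^ q) (L t b)))
    (B := ‖φ‖ * ‖a‖ * ‖b‖) (M := K * (‖a‖ * ‖b‖)) (E := zeroProductSeminorm φ * (‖a‖ * ‖L t b‖))
    (fun p q ↦ ?_) (by positivity) (h.isSmallOnZeroProducts φ t a (L t b)) fun n ↦ ?_
  · simp only [zpow_one, zpow_neg, zpow_zero, h.right_one, h.left_one, hinv] at key
    refine key.trans ?_
    have h1 : zeroProductSeminorm φ * (‖a‖ * ‖L t b‖) ≤ zeroProductSeminorm φ * (‖a‖ * ‖b‖) := by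
      gcongr
      exact h.norm_left_le _ _
    have h2 : 0 ≤ Real.sin (Real.pi / 10) :=
      Real.sin_nonneg_of_nonneg_of_le_pi (by positivity) (by linarith [Real.pi_pos])
    have h3 := mul_le_mul_of_nonneg_left h1
      (show 0 ≤ 240 * (1 + Real.sin (Real.pi / 10)) by positivity)
    linarith
  · refine (φ.le_opNorm₂ _ _).trans ?_
    gcongr
    · exact h.norm_right_le _ _
    · exact (h.norm_left_le _ _).trans (h.norm_left_le _ _)
  · have h1 := hK (t ^ n) a (L (t ^ (-n)) (L t b))
    simp only [zpow_neg, zpow_zero, h.right_one, h.left_one, hinv'] at h1 ⊢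
    refine h1.trans ?_
    gcongr
    exact (h.norm_left_le _ _).trans (h.norm_left_le _ _)

lemma _root_.two_mul_sin_pi_div_ten_lt_one : 2 * Real.sin (Real.pi / 10) < 1 := by
  have h1 : Real.sin (Real.pi / 10) < Real.sin (Real.pi / 6) :=
    Real.sin_lt_sin_of_lt_of_le_pi_div_two (by linarith [Real.pi_pos]) (by linarith [Real.pi_pos])
      (by linarith [Real.pi_pos])
  rw [Real.sin_pi_div_six] at h1
  linarith

/-- The best constant `K` in `‖φ (R t a) b - φ a (L t b)‖ ≤ K * (‖a‖ * ‖b‖)` satisfies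
`K ≤ 2 s K + C`, where `s = sin (π/10)` is less than `1/2`. -/
theorem defect_le (h : IsMultiplierAction R L) (φ : A →L[ℂ] A →L[ℂ] ℂ) (t : G) (a b : A) :
    ‖φ (R t a) b - φ a (L t b)‖ ≤ 240 * ((1 + Real.sin (Real.pi / 10)) /
      (1 - 2 * Real.sin (Real.pi / 10))) * zeroProductSeminorm φ * (‖a‖ * ‖b‖) := by
  set s := Real.sin (Real.pi / 10) with hs
  have hs1 : 0 < 1 - 2 * s := by linarith [two_mul_sin_pi_div_ten_lt_one]
  have hs0 : 0 ≤ s :=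
      Real.sin_nonneg_of_nonneg_of_le_pi (by positivity) (by linarith [Real.pi_pos])
  have hz := zeroProductSeminorm_nonneg φ
  let S : Set ℝ := {K | 0 ≤ K ∧ ∀ t a b, ‖φ (R t a) b - φ a (L t b)‖ ≤ K * (‖a‖ * ‖b‖)}
  have hne : S.Nonempty := by
    refine ⟨2 * ‖φ‖, by positivity, fun t a b ↦ (norm_sub_le _ _).trans ?_⟩
    have h1 : ‖φ (R t a) b‖ ≤ ‖φ‖ * ‖a‖ * ‖b‖ := (φ.le_opNorm₂ _ _).trans (by
      gcongr
      exact h.norm_right_le _ _)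
    have h2 : ‖φ a (L t b)‖ ≤ ‖φ‖ * ‖a‖ * ‖b‖ := (φ.le_opNorm₂ _ _).trans (by
      gcongr
      exact h.norm_left_le _ _)
    linarith
  have hb : BddBelow S := ⟨0, fun K hK ↦ hK.1⟩
  have hle : ∀ K ∈ S, sInf S ≤ 2 * s * K + 240 * (1 + s) * zeroProductSeminorm φ := fun K hK ↦
    csInf_le hb ⟨by have := hK.1; positivity, h.defect_bound_improve φ hK.2 hK.1⟩
  have hcl : sInf S ∈ S := by
    refine IsClosed.csInf_mem ?_ hne hb
    have hS : S = Set.Ici 0 ∩ ⋂ (t : G) (a : A) (b : A),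
        {K | ‖φ (R t a) b - φ a (L t b)‖ ≤ K * (‖a‖ * ‖b‖)} := by
      ext K
      simp [S]
    rw [hS]
    exact isClosed_Ici.inter <| isClosed_iInter fun t ↦ isClosed_iInter fun a ↦ isClosed_iInter fun b ↦
      isClosed_le continuous_const (continuous_id.mul continuous_const)
  have h1 := hle _ hcl
  have h2 : sInf S ≤ 240 * ((1 + s) / (1 - 2 * s)) * zeroProductSeminorm φ := by
    rw [mul_div_assoc', div_mul_eq_mul_div, le_div_iff₀ hs1]
    linarith
  exact (hcl.2 t a b).trans (by gcongr)

end IsMultiplierAction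

end Multipliers

/-! ### Translations on `L¹(G)` -/

section Translation

open MeasureTheory Filter Topology Function
open scoped ENNReal Pointwise NNReal

variable {G : Type*} [Group G] [TopologicalSpace G] [IsTopologicalGroup G] [LocallyCompactSpace G]
  [MeasurableSpace G] [BorelSpace G] {μ : Measure G} [μ.IsHaarMeasure] [μ.Regular]

lemma map_mul_right_haar (t : G) : μ.map (· * t) = Measure.modularCharacterFun t • μ := by
  have : (μ.map (· * t)).Regular := Measure.Regular.map (Homeomorph.mulRight t)
  rw [Measure.modularCharacterFun_eq_haarScalarFactor μ t]
  exact Measure.isMulLeftInvariant_eq_smul_of_regular _ μ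

lemma quasiMeasurePreserving_mul_right_haar (t : G) :
    Measure.QuasiMeasurePreserving (· * t) μ μ :=
  ⟨measurable_mul_const t, by rw [map_mul_right_haar]; exact Measure.smul_absolutelyContinuous⟩

lemma integral_mul_right_haar {E : Type*} [NormedAddCommGroup E] [NormedSpace ℝ E] (t : G)
    (F : G → E) : ∫ x, F (x * t) ∂μ = (Measure.modularCharacterFun t : ℝ) • ∫ x, F x ∂μ := by
  have h := integral_map_equiv (μ := μ) (MeasurableEquiv.mulRight t) F
  rw [← NNReal.smul_def, ← integral_smul_nnreal_measure, ← map_mul_right_haar]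
  exact h.symm

lemma integrable_mul_right_haar {E : Type*} [NormedAddCommGroup E] (t : G)
    {F : G → E} (hF : Integrable F μ) : Integrable (fun x ↦ F (x * t)) μ := by
  have h := integrable_map_equiv (μ := μ) (MeasurableEquiv.mulRight t) F
  refine h.1 ?_
  change Integrable F (μ.map (· * t))
  rw [map_mul_right_haar]
  exact hF.smul_measure_nnreal

lemma modularCharacterFun_mul_inv (t : G) : (Measure.modularCharacterFun t : ℝ) *
    Measure.modularCharacterFun t⁻¹ = 1 := by
  rw [← NNReal.coe_mul, ← Measure.modularCharacterFun_map_mul, mul_inv_cancel,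
    Measure.modularCharacterFun_map_one, NNReal.coe_one]

lemma continuous_modularCharacterFun :
    Continuous fun t : G ↦ (Measure.modularCharacterFun t : ℝ) := by
  let μ : Measure G := Measure.haar
  obtain ⟨⟨g, g_cont⟩, g_comp, g_nonneg, g_one⟩ :
    ∃ g : C(G, ℝ), HasCompactSupport g ∧ 0 ≤ g ∧ g 1 ≠ 0 := exists_continuous_nonneg_pos 1
  have hI : 0 < ∫ x, g x ∂μ :=
    g_cont.integral_pos_of_hasCompactSupport_nonneg_nonzero g_comp g_nonneg g_one
  have hD : Continuous fun y ↦ ∫ z, g (z⁻¹ * y) ∂μ.inv :=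
    continuous_integral_apply_inv_mul g_cont g_comp
  refine (hD.div_const (∫ x, g x ∂μ)).congr fun t ↦ ?_
  have h1 : ∫ z, g (z⁻¹ * t) ∂μ.inv = ∫ z, g (z * t) ∂μ := by
    have := integral_map_equiv (μ := μ) (MeasurableEquiv.inv G) fun z ↦ g (z⁻¹ * t)
    simpa using! this
  rw [h1, integral_mul_right_haar t g, smul_eq_mul, mul_div_cancel_right₀ _ hI.ne']

/-- Convolution by the point mass at `t` on the left, `f ↦ f (t⁻¹ ·)`. -/
noncomputable def l1LeftTranslate (t : G) : Lp ℂ 1 μ →L[ℂ] Lp ℂ 1 μ :=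
  LinearMap.mkContinuous
    { toFun := fun k ↦ DomMulAct.mk t⁻¹ • k
      map_add' := fun a b ↦ smul_add _ _ _
      map_smul' := fun c a ↦ smul_comm _ _ _ } 1 fun k ↦ by
        rw [one_mul]
        exact (DomMulAct.norm_smul_Lp _ _).le

lemma l1LeftTranslate_apply (t : G) (f : Lp ℂ 1 μ) :
    l1LeftTranslate t f = DomMulAct.mk t⁻¹ • f := rfl

lemma norm_l1LeftTranslate (t : G) (f : Lp ℂ 1 μ) : ‖l1LeftTranslate t f‖ = ‖f‖ :=
  DomMulAct.norm_smul_Lp _ _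

lemma integrable_rightTranslate (t : G) (f : Lp ℂ 1 μ) :
    Integrable (fun x ↦ ((Measure.modularCharacterFun t : ℝ) : ℂ) * f (x * t⁻¹)) μ :=
  (integrable_mul_right_haar t⁻¹ (L1.integrable_coeFn f)).const_mul _

lemma integral_norm_rightTranslate (t : G) (f : G → ℂ) :
    ∫ x, ‖((Measure.modularCharacterFun t : ℝ) : ℂ) * f (x * t⁻¹)‖ ∂μ = ∫ x, ‖f x‖ ∂μ := by
  have h := integral_mul_right_haar (μ := μ) t⁻¹ fun x ↦ ‖((Measure.modularCharacterFun t : ℝ) : ℂ) * f x‖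
  rw [h]
  simp only [norm_mul, Complex.norm_real, NNReal.norm_eq]
  rw [integral_const_mul, smul_eq_mul, ← mul_assoc, mul_comm (Measure.modularCharacterFun t⁻¹ : ℝ),
    modularCharacterFun_mul_inv, one_mul]

/-- Convolution by the point mass at `t` on the right, `f ↦ Δ(t) f (· t⁻¹)`. The modular character
`Δ` is normalized so that `∫ f (x t) dx = Δ(t) ∫ f (x) dx`. -/
noncomputable def l1RightTranslate (t : G) : Lp ℂ 1 μ →L[ℂ] Lp ℂ 1 μ :=
  LinearMap.mkContinuous
    { toFun := fun f ↦ (integrable_rightTranslate t f).toL1 _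
      map_add' := fun f g ↦ by
        rw [← Integrable.toL1_add]
        refine (Integrable.toL1_eq_toL1_iff _ _ _ _).2 ?_
        filter_upwards [(quasiMeasurePreserving_mul_right_haar t⁻¹).ae (Lp.coeFn_add f g)]
          with x hx
        rw [hx, Pi.add_apply, Pi.add_apply, mul_add]
      map_smul' := fun c f ↦ by
        rw [RingHom.id_apply, ← Integrable.toL1_smul']
        refine (Integrable.toL1_eq_toL1_iff _ _ _ _).2 ?_
        filter_upwards [(quasiMeasurePreserving_mul_right_haar t⁻¹).ae (Lp.coeFn_smul c f)]
          with x hx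
        rw [hx, Pi.smul_apply, Pi.smul_apply, smul_eq_mul, smul_eq_mul]
        ring }
    1 fun f ↦ by
      rw [one_mul, L1.norm_eq_integral_norm f, ← integral_norm_rightTranslate t f]
      exact (L1.norm_of_fun_eq_integral_norm (integrable_rightTranslate t f)).le

lemma l1RightTranslate_coe (t : G) (f : Lp ℂ 1 μ) :
    l1RightTranslate t f =ᵐ[μ] fun x ↦ ((Measure.modularCharacterFun t : ℝ) : ℂ) * f (x * t⁻¹) :=
  (integrable_rightTranslate t f).coeFn_toL1

lemma norm_l1RightTranslate (t : G) (f : Lp ℂ 1 μ) : ‖l1RightTranslate t f‖ = ‖f‖ := by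
  rw [L1.norm_eq_integral_norm f, ← integral_norm_rightTranslate t f]
  exact L1.norm_of_fun_eq_integral_norm (integrable_rightTranslate t f)

lemma l1RightTranslate_coe_of_ae_eq (t : G) {f : Lp ℂ 1 μ} {h : G → ℂ} (hf : f =ᵐ[μ] h) :
    l1RightTranslate t f =ᵐ[μ] fun x ↦ ((Measure.modularCharacterFun t : ℝ) : ℂ) * h (x * t⁻¹) := by
  filter_upwards [l1RightTranslate_coe t f,
    (quasiMeasurePreserving_mul_right_haar t⁻¹).ae hf] with x h1 h2
  rw [h1, h2]

lemma l1RightTranslate_mul (t : G) (a b : Lp ℂ 1 μ) :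
    l1BochnerConv (l1RightTranslate t a) b = l1BochnerConv a (l1LeftTranslate t b) := by
  suffices h : ∀ x, convFun μ (l1RightTranslate t a) b x = convFun μ a (l1LeftTranslate t b) x by
    refine Lp.ext ((l1BochnerConv_ae_eq _ _).trans ?_)
    rw [funext h]
    exact (l1BochnerConv_ae_eq _ _).symm
  intro x
  have h1 : convFun μ (l1RightTranslate t a) b x =
      ∫ s, ((Measure.modularCharacterFun t : ℝ) : ℂ) * (a (s * t⁻¹) * b (t⁻¹ * (s * t⁻¹)⁻¹ * x)) ∂μ := by
    refine integral_congr_ae ?_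
    filter_upwards [l1RightTranslate_coe t a] with s hs
    rw [hs, mul_inv_rev, inv_inv, inv_mul_cancel_left, mul_assoc]
  have h2 : convFun μ a (l1LeftTranslate t b) x = ∫ s, a s * b (t⁻¹ * s⁻¹ * x) ∂μ := by
    refine integral_congr_ae ?_
    filter_upwards [l1_ae_inv a (l1_translate_coe t b) x] with s hs
    by_cases h0 : a s = 0
    · rw [h0, zero_mul, zero_mul]
    · rw [l1LeftTranslate_apply, hs h0, mul_assoc]
  rw [h1, h2, integral_const_mul,
    integral_mul_right_haar (μ := μ) t⁻¹ fun s ↦ a s * b (t⁻¹ * s⁻¹ * x), Complex.real_smul,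
    ← mul_assoc, ← Complex.ofReal_mul, modularCharacterFun_mul_inv, Complex.ofReal_one, one_mul]

lemma l1RightTranslate_one (a : Lp ℂ 1 μ) : l1RightTranslate 1 a = a := by
  refine Lp.ext ((l1RightTranslate_coe 1 a).trans (ae_of_all _ fun x ↦ ?_))
  simp [Measure.modularCharacterFun_map_one]

lemma continuous_l1RightTranslate_of_hasCompactSupport {a : Lp ℂ 1 μ} {h : G → ℂ}
    (hc : Continuous h) (hs : HasCompactSupport h) (ha : a =ᵐ[μ] h) :
    Continuous fun t : G ↦ l1RightTranslate t a := by
  refine continuous_iff_continuousAt.2 fun t₀ ↦ ?_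
  obtain ⟨K, hK, hKt⟩ := exists_compact_mem_nhds t₀
  let F : G → G → ℝ := fun t x ↦ ‖((Measure.modularCharacterFun t : ℝ) : ℂ) * h (x * t⁻¹) -
    ((Measure.modularCharacterFun t₀ : ℝ) : ℂ) * h (x * t₀⁻¹)‖
  have hnorm : ∀ t, ‖l1RightTranslate t a - l1RightTranslate t₀ a‖ = ∫ x, F t x ∂μ := by
    intro t
    rw [L1.norm_eq_integral_norm]
    refine integral_congr_ae ?_
    filter_upwards [Lp.coeFn_sub (l1RightTranslate t a) (l1RightTranslate t₀ a),
      l1RightTranslate_coe_of_ae_eq t ha, l1RightTranslate_coe_of_ae_eq t₀ ha] with x h1 h2 h3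
    rw [h1, Pi.sub_apply, h2, h3]
  have hFc : Continuous (uncurry F) := by
    have h1 : Continuous fun p : G × G ↦ ((Measure.modularCharacterFun p.1 : ℝ) : ℂ) :=
      Complex.continuous_ofReal.comp (continuous_modularCharacterFun.comp continuous_fst)
    simp only [F, uncurry_def]
    fun_prop
  have hcont : ContinuousOn (fun t ↦ ∫ x, F t x ∂μ) K := by
    refine continuousOn_integral_of_compact_support (hs.isCompact.mul hK) hFc.continuousOn ?_
    intro t x ht hx
    have hz : ∀ t ∈ K, h (x * t⁻¹) = 0 := fun t ht ↦ by
      by_contra hne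
      exact hx ⟨x * t⁻¹, subset_closure hne, t, ht, by simp⟩
    simp [F, hz t ht, hz t₀ (mem_of_mem_nhds hKt)]
  have h0 : F t₀ = 0 := by
    ext x
    simp [F]
  have h1 := (hcont.continuousAt hKt).tendsto
  simp only [h0, Pi.zero_apply, integral_zero] at h1
  rw [ContinuousAt, tendsto_iff_norm_sub_tendsto_zero]
  simpa only [hnorm] using h1

/-- The classes of continuous functions with compact support are dense in `L¹`. -/
lemma l1_mem_of_isClosed {S : Set (Lp ℂ 1 μ)} (hS : IsClosed S)
    (h : ∀ (a : Lp ℂ 1 μ) (f : G → ℂ), Continuous f → HasCompactSupport f → a =ᵐ[μ] f → a ∈ S)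
    (a : Lp ℂ 1 μ) : a ∈ S := by
  obtain ⟨f, u, hc, hs, hu, hsum, ha⟩ := l1_exists_series a
  refine hS.mem_of_tendsto ha.tendsto_sum_nat (Eventually.of_forall fun n ↦ ?_)
  have key : ∃ g : G → ℂ, Continuous g ∧ HasCompactSupport g ∧
      ((∑ i ∈ Finset.range n, u i : Lp ℂ 1 μ) : G → ℂ) =ᵐ[μ] g := by
    induction n with
    | zero => exact ⟨0, continuous_zero, HasCompactSupport.zero, by
      simpa using Lp.coeFn_zero ℂ 1 μ⟩
    | succ n ih =>
      obtain ⟨g, h1, h2, h3⟩ := ih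
      rw [Finset.sum_range_succ]
      exact ⟨g + f n, h1.add (hc n), h2.add (hs n), (Lp.coeFn_add _ _).trans (h3.add (hu n))⟩
  obtain ⟨g, h1, h2, h3⟩ := key
  exact h _ g h1 h2 h3

lemma continuous_l1RightTranslate (a : Lp ℂ 1 μ) :
    Continuous fun t : G ↦ l1RightTranslate t a := by
  refine l1_mem_of_isClosed (S := {a | Continuous fun t : G ↦ l1RightTranslate t a}) ?_
    (fun a f hc hs ha ↦ continuous_l1RightTranslate_of_hasCompactSupport hc hs ha) a
  -- Uniform limits of continuous functions are continuous.
  refine isClosed_of_closure_subset fun a ha ↦ ?_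
  refine continuous_of_uniform_approx_of_continuous fun V hV ↦ ?_
  obtain ⟨ε, hε, hεV⟩ := Metric.mem_uniformity_dist.1 hV
  obtain ⟨b, hb, hab⟩ := Metric.mem_closure_iff.1 ha ε hε
  refine ⟨_, hb, fun t ↦ hεV ?_⟩
  rwa [dist_eq_norm, ← map_sub, norm_l1RightTranslate, ← dist_eq_norm]

lemma l1_integrable_smul_continuous {X : Type*} [NormedAddCommGroup X] [NormedSpace ℂ X]
    (f : Lp ℂ 1 μ) {F : G → X} (hF : Continuous F) {C : ℝ} (hC : ∀ t, ‖F t‖ ≤ C) :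
    Integrable (fun t ↦ f t • F t) μ := by
  have hm : AEStronglyMeasurable (fun t ↦ f t • F t) μ := by
    obtain ⟨h, u, h1, h2, h3, h4, h5⟩ := l1_exists_series f
    refine aestronglyMeasurable_of_tendsto_ae atTop
      (f := fun n t ↦ (∑ i ∈ Finset.range n, h i t) • F t) (fun n ↦ ?_) ?_
    · refine (Continuous.stronglyMeasurable_of_hasCompactSupport ?_ ?_).aestronglyMeasurable
      · exact (continuous_finsetSum _ fun i _ ↦ h1 i).smul hF
      · refine HasCompactSupport.smul_right (f := fun t ↦ ∑ i ∈ Finset.range n, h i t) ?_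
        induction n with
        | zero => simpa using! HasCompactSupport.zero
        | succ n ih => simpa [Finset.sum_range_succ] using! ih.add (h2 n)
    · filter_upwards [l1_hasSum_ae u _ h4 h5, ae_all_iff.2 h3] with t a b
      have := a.2.tendsto_sum_nat
      simp only [b] at this
      exact this.smul_const _
  refine ((L1.integrable_coeFn f).norm.mul_const C).mono' hm (ae_of_all _ fun t ↦ ?_)
  rw [norm_smul]
  exact mul_le_mul_of_nonneg_left (hC t) (norm_nonneg _)

lemma l1_integrable_mul {g : G → ℂ} (gc : Continuous g) (gs : HasCompactSupport g)
    (u : Lp ℂ 1 μ) : Integrable (fun x ↦ g x * u x) μ := by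
  obtain ⟨C, hC⟩ := gs.exists_bound_of_continuous gc
  exact (L1.integrable_coeFn u).bdd_mul
    (gc.stronglyMeasurable_of_hasCompactSupport gs).aestronglyMeasurable (ae_of_all _ hC)

/-- Integration against a continuous function with compact support, as a functional on `L¹`. -/
noncomputable def l1Pairing {g : G → ℂ} (gc : Continuous g) (gs : HasCompactSupport g) :
    Lp ℂ 1 μ →L[ℂ] ℂ :=
  LinearMap.mkContinuousOfExistsBound
    { toFun := fun u ↦ ∫ x, g x * u x ∂μ
      map_add' := fun u v ↦ by
        rw [← integral_add (l1_integrable_mul gc gs u) (l1_integrable_mul gc gs v)]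
        refine integral_congr_ae ((Lp.coeFn_add u v).mono fun x hx ↦ ?_)
        simp only [hx, Pi.add_apply, mul_add]
      map_smul' := fun c u ↦ by
        rw [RingHom.id_apply, ← integral_smul]
        refine integral_congr_ae ((Lp.coeFn_smul c u).mono fun x hx ↦ ?_)
        simp only [hx, Pi.smul_apply, smul_eq_mul]
        ring } <| by
    obtain ⟨C, hC⟩ := gs.exists_bound_of_continuous gc
    refine ⟨C, fun u ↦ ?_⟩
    rw [L1.norm_eq_integral_norm, ← integral_const_mul]
    refine norm_integral_le_of_norm_le ((L1.integrable_coeFn u).norm.const_mul C)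
      (ae_of_all _ fun x ↦ ?_)
    rw [norm_mul]
    exact mul_le_mul_of_nonneg_right (hC x) (norm_nonneg _)

lemma l1Pairing_apply {g : G → ℂ} (gc : Continuous g) (gs : HasCompactSupport g)
    (u : Lp ℂ 1 μ) : l1Pairing gc gs u = ∫ x, g x * u x ∂μ := rfl

lemma norm_l1Pairing_le {g : G → ℂ} (gc : Continuous g) (gs : HasCompactSupport g)
    (hg : ∀ x, ‖g x‖ ≤ 1) (u : Lp ℂ 1 μ) : ‖l1Pairing gc gs u‖ ≤ ‖u‖ := by
  rw [L1.norm_eq_integral_norm]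
  refine norm_integral_le_of_norm_le (L1.integrable_coeFn u).norm (ae_of_all _ fun x ↦ ?_)
  rw [norm_mul]
  exact mul_le_of_le_one_left (norm_nonneg _) (hg x)

/-- Integration against a continuous function with compact support separates points of `L¹`. -/
lemma l1_eq_zero_of_forall_integral_mul_eq_zero {c : Lp ℂ 1 μ}
    (h : ∀ g : G → ℂ, Continuous g → HasCompactSupport g → ∫ x, g x * c x ∂μ = 0) : c = 0 := by
  have key : ∀ δ : ℝ, 0 < δ → ‖c‖ ≤ 2 * δ := by
    intro δ hδ
    have hmem : ∃ (a : Lp ℂ 1 μ) (k : G → ℂ), Continuous k ∧ HasCompactSupport k ∧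
        a =ᵐ[μ] k ∧ ‖c - a‖ ≤ δ := by
      have h1 : c ∈ closure {a : Lp ℂ 1 μ | ∃ k : G → ℂ, Continuous k ∧ HasCompactSupport k ∧
          a =ᵐ[μ] k} := by
        refine l1_mem_of_isClosed isClosed_closure (fun a f h1 h2 h3 ↦ subset_closure ?_) c
        exact ⟨f, h1, h2, h3⟩
      obtain ⟨a, ⟨k, h1, h2, h3⟩, h4⟩ := Metric.mem_closure_iff.1 h1 δ hδ
      exact ⟨a, k, h1, h2, h3, by rw [← dist_eq_norm]; exact h4.le⟩
    obtain ⟨a, k, kc, ks, ha, hca⟩ := hmem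
    have hS : μ (tsupport k) ≠ ∞ := ks.isCompact.measure_lt_top.ne
    have ha' : ‖a‖ = ∫ x, ‖k x‖ ∂μ := by
      rw [L1.norm_eq_integral_norm]
      exact integral_congr_ae (ha.mono fun x hx ↦ by simp only [hx])
    have hη : ∀ η : ℝ, 0 < η → ‖a‖ ≤ δ + η * μ.real (tsupport k) := by
      intro η hη
      -- The test function is a regularization of the phase of `k`.
      let g : G → ℂ := fun x ↦ (starRingEnd ℂ) (k x) * (((‖k x‖ + η)⁻¹ : ℝ) : ℂ)
      have hpos : ∀ x, 0 < ‖k x‖ + η := fun x ↦ by positivity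
      have gc : Continuous g := by
        have h1 : Continuous fun x ↦ (‖k x‖ + η)⁻¹ :=
          (kc.norm.add continuous_const).inv₀ fun x ↦ (hpos x).ne'
        exact (Complex.continuous_conj.comp kc).mul (Complex.continuous_ofReal.comp h1)
      have gs : HasCompactSupport g :=
        (ks.comp_left (g := starRingEnd ℂ) (map_zero _)).mul_right
      have g1 : ∀ x, ‖g x‖ ≤ 1 := fun x ↦ by
        simp only [g]
        rw [norm_mul, RCLike.norm_conj, Complex.norm_real, Real.norm_of_nonneg (by positivity),
          ← div_eq_mul_inv, div_le_one (hpos x)]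
        linarith
      have gk : ∀ x, g x * k x = ((‖k x‖ ^ 2 * (‖k x‖ + η)⁻¹ : ℝ) : ℂ) := fun x ↦ by
        simp only [g]
        rw [mul_right_comm, mul_comm (starRingEnd ℂ _), Complex.mul_conj, Complex.normSq_eq_norm_sq]
        push_cast
        ring
      have i1 : Integrable (fun x ↦ ‖k x‖ ^ 2 * (‖k x‖ + η)⁻¹) μ := by
        refine Continuous.integrable_of_hasCompactSupport ((kc.norm.pow 2).mul
          ((kc.norm.add continuous_const).inv₀ fun x ↦ (hpos x).ne')) ?_
        exact (ks.comp_left (g := fun z : ℂ ↦ ‖z‖ ^ 2) (by simp)).mul_right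
      have i2 : Integrable (fun x ↦ (tsupport k).indicator (fun _ ↦ η) x) μ :=
        (integrable_indicator_iff (isClosed_tsupport k).measurableSet).2 (integrableOn_const hS)
      have e1 : ∫ x, ‖k x‖ ∂μ ≤ ∫ x, ‖k x‖ ^ 2 * (‖k x‖ + η)⁻¹ ∂μ + η * μ.real (tsupport k) := by
        have e2 : η * μ.real (tsupport k) = ∫ x, (tsupport k).indicator (fun _ ↦ η) x ∂μ := by
          rw [integral_indicator_const _ (isClosed_tsupport k).measurableSet, smul_eq_mul, mul_comm]
        rw [e2, ← integral_add i1 i2]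
        refine integral_mono (kc.norm.integrable_of_hasCompactSupport ks.norm) (i1.add i2) fun x ↦ ?_
        by_cases hx : x ∈ tsupport k
        · rw [Set.indicator_of_mem hx, ← div_eq_mul_inv, ← sub_le_iff_le_add, le_div_iff₀ (hpos x)]
          nlinarith [norm_nonneg (k x)]
        · simp [image_eq_zero_of_notMem_tsupport hx, hx]
      have e3 : ∫ x, ‖k x‖ ^ 2 * (‖k x‖ + η)⁻¹ ∂μ ≤ δ := by
        have e4 : ((∫ x, ‖k x‖ ^ 2 * (‖k x‖ + η)⁻¹ ∂μ : ℝ) : ℂ) = l1Pairing gc gs (a - c) := by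
          rw [map_sub, l1Pairing_apply gc gs c, h g gc gs, sub_zero, l1Pairing_apply,
            ← integral_complex_ofReal]
          refine integral_congr_ae (ha.mono fun x hx ↦ ?_)
          simp only [hx, gk]
        have e5 := (norm_l1Pairing_le gc gs g1 (a - c)).trans ((norm_sub_rev a c).trans_le hca)
        rw [← e4, Complex.norm_real] at e5
        exact (Real.le_norm_self _).trans e5
      rw [ha']
      linarith
    have hlim : ‖a‖ ≤ δ := by
      have h1 : Tendsto (fun η : ℝ ↦ δ + η * μ.real (tsupport k)) (𝓝[>] 0) (𝓝 (δ + 0 * _)) :=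
        ((continuous_const.add (continuous_id.mul continuous_const)).tendsto 0).mono_left
          nhdsWithin_le_nhds
      rw [zero_mul, add_zero] at h1
      exact ge_of_tendsto h1 (eventually_mem_nhdsWithin.mono hη)
    calc ‖c‖ = ‖(c - a) + a‖ := by rw [sub_add_cancel]
      _ ≤ ‖c - a‖ + ‖a‖ := norm_add_le _ _
      _ ≤ 2 * δ := by linarith
  refine norm_le_zero_iff.1 (le_of_forall_pos_le_add fun ε hε ↦ ?_)
  have := key (ε / 2) (by positivity)
  linarith

lemma l1_integrable_smul_rightTranslate (f a : Lp ℂ 1 μ) :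
    Integrable (fun t ↦ f t • l1RightTranslate t a) μ :=
  l1_integrable_smul_continuous f (continuous_l1RightTranslate a)
    fun t ↦ (norm_l1RightTranslate t a).le

/-- The Bochner integral `∫ f(t) • (a * δ_t) dt`, which turns out to be `a * f`. -/
noncomputable def l1RightBochnerConv : Lp ℂ 1 μ →L[ℂ] Lp ℂ 1 μ →L[ℂ] Lp ℂ 1 μ :=
  LinearMap.mkContinuous₂
    (LinearMap.mk₂ ℂ (fun a f ↦ ∫ t, f t • l1RightTranslate t a ∂μ)
      (fun a a' f ↦ by
        rw [← integral_add (l1_integrable_smul_rightTranslate f a)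
          (l1_integrable_smul_rightTranslate f a')]
        simp only [map_add, smul_add])
      (fun c a f ↦ by
        rw [← integral_smul]
        simp only [map_smul, smul_comm c])
      (fun a f f' ↦ by
        rw [← integral_add (l1_integrable_smul_rightTranslate f a)
          (l1_integrable_smul_rightTranslate f' a)]
        refine integral_congr_ae ((Lp.coeFn_add f f').mono fun t h ↦ ?_)
        simp only [h, Pi.add_apply, add_smul])
      (fun c a f ↦ by
        rw [← integral_smul]
        refine integral_congr_ae ((Lp.coeFn_smul c f).mono fun t h ↦ ?_)
        simp only [h, Pi.smul_apply, smul_assoc]))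
    1 fun a f ↦ by
      rw [LinearMap.mk₂_apply, one_mul, L1.norm_eq_integral_norm f, mul_comm, ← integral_mul_const]
      refine (norm_integral_le_integral_norm _).trans (le_of_eq ?_)
      simp only [norm_smul, norm_l1RightTranslate]

lemma l1RightBochnerConv_apply (a f : Lp ℂ 1 μ) :
    l1RightBochnerConv a f = ∫ t, f t • l1RightTranslate t a ∂μ := rfl

lemma l1Pairing_rightTranslate {g : G → ℂ} (gc : Continuous g) (gs : HasCompactSupport g) (t : G)
    (a : Lp ℂ 1 μ) : l1Pairing gc gs (l1RightTranslate t a) = ∫ x, g (x * t) * a x ∂μ := by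
  have h := integral_mul_right_haar (μ := μ) t⁻¹ fun x ↦ g (x * t) * a x
  have e : l1Pairing gc gs (l1RightTranslate t a) =
      ∫ x, ((Measure.modularCharacterFun t : ℝ) : ℂ) * (g (x * t⁻¹ * t) * a (x * t⁻¹)) ∂μ := by
    refine integral_congr_ae ((l1RightTranslate_coe t a).mono fun x hx ↦ ?_)
    simp only [hx, inv_mul_cancel_right]
    ring
  rw [e, integral_const_mul, h, Complex.real_smul, ← mul_assoc, ← Complex.ofReal_mul,
    modularCharacterFun_mul_inv, Complex.ofReal_one, one_mul]

lemma l1Pairing_leftTranslate {g : G → ℂ} (gc : Continuous g) (gs : HasCompactSupport g) (t : G)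
    (a : Lp ℂ 1 μ) : l1Pairing gc gs (l1LeftTranslate t a) = ∫ x, g (t * x) * a x ∂μ := by
  rw [← integral_mul_left_eq_self _ t⁻¹, l1Pairing_apply]
  refine integral_congr_ae ((l1_translate_coe t a).mono fun x hx ↦ ?_)
  rw [← l1LeftTranslate_apply] at hx
  simp only [hx, mul_inv_cancel_left]

/-- Both sides have the same integral against every continuous function with compact support. -/
theorem l1RightBochnerConv_eq (a f : Lp ℂ 1 μ) : l1RightBochnerConv a f = l1BochnerConv a f := by
  have c1 : Continuous fun a : Lp ℂ 1 μ ↦ l1RightBochnerConv a f :=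
    (l1RightBochnerConv (μ := μ)).continuous.clm_apply continuous_const
  have c2 : Continuous fun a : Lp ℂ 1 μ ↦ l1BochnerConv a f :=
    (l1BochnerConv (μ := μ)).continuous.clm_apply continuous_const
  refine l1_mem_of_isClosed (S := {a | l1RightBochnerConv a f = l1BochnerConv a f})
    (isClosed_eq c1 c2) (fun a h hc hs ha ↦ ?_) a
  refine l1_mem_of_isClosed (S := {f | l1RightBochnerConv a f = l1BochnerConv a f})
    (isClosed_eq (l1RightBochnerConv a).continuous (l1BochnerConv a).continuous)
    (fun f k kc ks hf ↦ ?_) f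
  -- Both sides pair with `g` to `∬ a(x) f(t) g(x t) dx dt`.
  change l1RightBochnerConv a f = l1BochnerConv a f
  rw [← sub_eq_zero]
  refine l1_eq_zero_of_forall_integral_mul_eq_zero fun g gc gs ↦ ?_
  rw [← l1Pairing_apply gc gs, map_sub, sub_eq_zero]
  have e1 : l1Pairing gc gs (l1RightBochnerConv a f) =
      ∫ t, ∫ x, k t * (g (x * t) * h x) ∂μ ∂μ := by
    rw [l1RightBochnerConv_apply,
      ← ContinuousLinearMap.integral_comp_comm _ (l1_integrable_smul_rightTranslate f a)]
    refine integral_congr_ae (hf.mono fun t ht ↦ ?_)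
    simp only [map_smul, smul_eq_mul, l1Pairing_rightTranslate, ht, integral_const_mul]
    congr 1
    exact integral_congr_ae (ha.mono fun x hx ↦ by simp only [hx])
  have e2 : l1Pairing gc gs (l1BochnerConv a f) =
      ∫ x, ∫ t, k t * (g (x * t) * h x) ∂μ ∂μ := by
    rw [l1BochnerConv_apply, ← ContinuousLinearMap.integral_comp_comm _
      (l1_integrable_smul_translate (L1.integrable_coeFn a) f)]
    refine integral_congr_ae (ha.mono fun x hx ↦ ?_)
    simp only [map_smul, smul_eq_mul, ← l1LeftTranslate_apply, l1Pairing_leftTranslate, hx]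
    rw [← integral_const_mul]
    refine integral_congr_ae (hf.mono fun t ht ↦ ?_)
    simp only [ht]
    ring
  rw [e1, e2]
  refine integral_integral_swap_of_hasCompactSupport ?_ ?_
  · simp only [uncurry_def]
    fun_prop
  · refine HasCompactSupport.of_support_subset_isCompact (ks.isCompact.prod hs.isCompact) ?_
    rintro ⟨t, x⟩ hne
    exact ⟨subset_closure (left_ne_zero_of_mul hne),
      subset_closure (right_ne_zero_of_mul (right_ne_zero_of_mul hne))⟩

end Translation

/-! ### The seminorms and the approximate identity -/

section Seminorms

open Filter Topology

variable {A : Type*} [NonUnitalNormedRing A] [NormedSpace ℂ A] [IsScalarTower ℂ A A]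
  [SMulCommClass ℂ A A]

lemma balancedSeminorm_nonneg (φ : A →L[ℂ] A →L[ℂ] ℂ) : 0 ≤ balancedSeminorm φ := by
  refine Real.sSup_nonneg ?_
  rintro r ⟨a, b, c, -, -, -, rfl⟩
  exact norm_nonneg _

lemma norm_mul_sub_le_balancedSeminorm (φ : A →L[ℂ] A →L[ℂ] ℂ) (a b c : A) :
    ‖φ (a * b) c - φ a (b * c)‖ ≤ balancedSeminorm φ * (‖a‖ * ‖b‖ * ‖c‖) := by
  by_cases ha : a = 0
  · simp [ha]
  by_cases hb : b = 0
  · simp [hb]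
  by_cases hc : c = 0
  · simp [hc]
  have hbdd : BddAbove {r : ℝ | ∃ a b c : A, ‖a‖ = 1 ∧ ‖b‖ = 1 ∧ ‖c‖ = 1 ∧
      r = ‖φ (a * b) c - φ a (b * c)‖} := by
    refine ⟨‖φ‖ + ‖φ‖, ?_⟩
    rintro r ⟨a, b, c, ha, hb, hc, rfl⟩
    refine (norm_sub_le _ _).trans (add_le_add ?_ ?_)
    · refine (φ.le_opNorm₂ _ _).trans ?_
      rw [hc, mul_one]
      refine mul_le_of_le_one_right (norm_nonneg φ) ((norm_mul_le a b).trans ?_)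
      rw [ha, hb, one_mul]
    · refine (φ.le_opNorm₂ _ _).trans ?_
      rw [ha, mul_one]
      refine mul_le_of_le_one_right (norm_nonneg φ) ((norm_mul_le b c).trans ?_)
      rw [hc, hb, one_mul]
  have h := le_csSup hbdd ⟨((‖a‖⁻¹ : ℝ) : ℂ) • a, ((‖b‖⁻¹ : ℝ) : ℂ) • b, ((‖c‖⁻¹ : ℝ) : ℂ) • c,
    norm_inv_smul_self ha, norm_inv_smul_self hb, norm_inv_smul_self hc, rfl⟩
  have ha' : 0 < ‖a‖ := norm_pos_iff.2 ha
  have hb' : 0 < ‖b‖ := norm_pos_iff.2 hb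
  have hc' : 0 < ‖c‖ := norm_pos_iff.2 hc
  have e : ∀ x y z : ℂ, φ ((x • a) * (y • b)) (z • c) - φ (x • a) ((y • b) * (z • c)) =
      x * y * z * (φ (a * b) c - φ a (b * c)) := fun x y z ↦ by
    rw [smul_mul_smul_comm, smul_mul_smul_comm]
    simp only [map_smul, smul_apply, smul_eq_mul]
    ring
  rw [e] at h
  simp only [norm_mul, Complex.norm_real, norm_inv, norm_norm] at h
  calc ‖φ (a * b) c - φ a (b * c)‖
      = (‖a‖⁻¹ * ‖b‖⁻¹ * ‖c‖⁻¹ * ‖φ (a * b) c - φ a (b * c)‖) * (‖a‖ * ‖b‖ * ‖c‖) := by field_simp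
    _ ≤ _ := by
      gcongr
      exact h

lemma balancedSeminorm_le {φ : A →L[ℂ] A →L[ℂ] ℂ} {K : ℝ} (hK : 0 ≤ K)
    (h : ∀ a b c, ‖φ (a * b) c - φ a (b * c)‖ ≤ K * (‖a‖ * ‖b‖ * ‖c‖)) :
    balancedSeminorm φ ≤ K := by
  refine Real.sSup_le ?_ hK
  rintro r ⟨a, b, c, ha, hb, hc, rfl⟩
  simpa [ha, hb, hc] using h a b c

/-- The form `(a, b) ↦ ξ (a * b)`, where `ξ` is a weak-* limit point of the functionals `φ(e, ·)`
along a left approximate identity, is within `|φ|_b` of `φ`. -/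
lemma distProductForms_le_balancedSeminorm {ι : Type*} {l : Filter ι} [l.NeBot] {e : ι → A}
    (he : ∀ i, ‖e i‖ ≤ 1) (hl : ∀ a, Tendsto (fun i ↦ e i * a) l (𝓝 a))
    (φ : A →L[ℂ] A →L[ℂ] ℂ) : distProductForms φ ≤ balancedSeminorm φ := by
  let F : Ultrafilter ι := Ultrafilter.of l
  have hF : (F : Filter ι) ≤ l := Ultrafilter.of_le l
  let η : ι → WeakDual ℂ A := fun i ↦ StrongDual.toWeakDual (φ (e i))
  have hcomp := WeakDual.isCompact_closedBall (𝕜 := ℂ) (0 : StrongDual ℂ A) ‖φ‖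
  obtain ⟨ξ, -, hξ⟩ := hcomp.ultrafilter_le_nhds (F.map η) (by
    refine le_principal_iff.2 (Filter.mem_map.2 (Filter.univ_mem' fun i ↦ ?_))
    change φ (e i) ∈ Metric.closedBall 0 ‖φ‖
    rw [mem_closedBall_zero_iff]
    exact (φ.le_opNorm _).trans (mul_le_of_le_one_right (norm_nonneg φ) (he i)))
  have hξ' : ∀ b, Tendsto (fun i ↦ φ (e i) b) F (𝓝 (ξ b)) := fun b ↦
    ((WeakDual.eval_continuous b).tendsto ξ).comp hξ
  let ξ' : A →L[ℂ] ℂ := WeakDual.toStrongDual ξ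
  let ψ : A →L[ℂ] A →L[ℂ] ℂ :=
    (ContinuousLinearMap.compL ℂ A A ℂ ξ').comp (ContinuousLinearMap.mul ℂ A)
  have hψ : ∀ a b, ψ a b = ξ' (a * b) := fun a b ↦ rfl
  have hd : distProductForms φ ≤ ‖φ - ψ‖ := by
    refine csInf_le ⟨0, ?_⟩ ⟨ψ, ⟨ξ', hψ⟩, rfl⟩
    rintro r ⟨χ, -, rfl⟩
    exact norm_nonneg (φ - χ)
  refine hd.trans ?_
  refine ContinuousLinearMap.opNorm_le_bound₂ _ (balancedSeminorm_nonneg φ) fun a b ↦ ?_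
  have h1 : Tendsto (fun i ↦ ‖φ (e i * a) b - φ (e i) (a * b)‖) F (𝓝 ‖φ a b - ξ (a * b)‖) := by
    have h2 : Tendsto (fun i ↦ φ (e i * a) b) F (𝓝 (φ a b)) :=
      (((φ.continuous.clm_apply continuous_const).tendsto a).comp (hl a)).mono_left hF
    exact (h2.sub (hξ' (a * b))).norm
  refine le_of_tendsto h1 (Eventually.of_forall fun i ↦ ?_)
  refine (norm_mul_sub_le_balancedSeminorm φ (e i) a b).trans ?_
  rw [mul_assoc ‖e i‖, mul_assoc (balancedSeminorm φ)]
  refine mul_le_mul_of_nonneg_left ?_ (balancedSeminorm_nonneg φ)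
  exact mul_le_of_le_one_left (by positivity) (he i)

end Seminorms

/-! ### The group algebra -/

section GroupAlgebra

open MeasureTheory Filter Topology
open scoped ENNReal

variable {G : Type*} [Group G] [TopologicalSpace G] [IsTopologicalGroup G] [LocallyCompactSpace G]
  [MeasurableSpace G] [BorelSpace G] {μ : Measure G} [μ.IsHaarMeasure] [μ.Regular]

/-- The normalized indicator function of a small open set acts on the left as an average of
translations. -/
lemma exists_l1_approximate_unit {U : Set G} (hU : U ∈ 𝓝 (1 : G)) : ∃ e : Lp ℂ 1 μ, ‖e‖ ≤ 1 ∧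
    ∀ (b : Lp ℂ 1 μ) (ε : ℝ), (∀ t ∈ U, ‖l1LeftTranslate t b - b‖ ≤ ε) →
      ‖l1BochnerConv e b - b‖ ≤ ε := by
  obtain ⟨K, hK, hK1⟩ := exists_compact_mem_nhds (1 : G)
  set V := interior (U ∩ K) with hV
  have h1V : (1 : G) ∈ V := mem_interior_iff_mem_nhds.2 (inter_mem hU hK1)
  have hVm : MeasurableSet V := isOpen_interior.measurableSet
  have hVU : V ⊆ U := interior_subset.trans Set.inter_subset_left
  have hfin : μ V ≠ ∞ :=
    ((measure_mono (interior_subset.trans Set.inter_subset_right)).trans_lt hK.measure_lt_top).ne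
  have hpos : 0 < μ.real V :=
    ENNReal.toReal_pos (isOpen_interior.measure_pos μ ⟨1, h1V⟩).ne' hfin
  have hn : ‖(((μ.real V)⁻¹ : ℝ) : ℂ)‖ = (μ.real V)⁻¹ := by
    rw [Complex.norm_real, Real.norm_of_nonneg (by positivity)]
  let e : Lp ℂ 1 μ := indicatorConstLp 1 hVm hfin (((μ.real V)⁻¹ : ℝ) : ℂ)
  refine ⟨e, ?_, fun b ε hb ↦ ?_⟩
  · rw [norm_indicatorConstLp one_ne_zero ENNReal.one_ne_top, hn]
    simp [hpos.ne']
  have hint : IntegrableOn (fun t : G ↦ l1LeftTranslate t b) V μ := by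
    have h2 := l1_integrable_smul_continuous (μ := μ) (indicatorConstLp 1 hVm hfin (1 : ℂ))
      (l1_translate_continuous b) fun t ↦ (DomMulAct.norm_smul_Lp (DomMulAct.mk t⁻¹) b).le
    rw [← integrable_indicator_iff hVm]
    refine h2.congr ((indicatorConstLp_coeFn (p := 1) (hs := hVm) (hμs := hfin) (c := (1 : ℂ))).mono
      fun t ht ↦ ?_)
    simp only [ht]
    by_cases htV : t ∈ V
    · simp [htV, l1LeftTranslate_apply]
    · simp [htV]
  have e1 : l1BochnerConv e b = (((μ.real V)⁻¹ : ℝ) : ℂ) • ∫ t in V, l1LeftTranslate t b ∂μ := by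
    rw [l1BochnerConv_apply, ← integral_indicator hVm, ← integral_smul]
    refine integral_congr_ae ((indicatorConstLp_coeFn (p := 1) (hs := hVm) (hμs := hfin)
      (c := (((μ.real V)⁻¹ : ℝ) : ℂ))).mono fun t ht ↦ ?_)
    simp only [e, ht]
    by_cases htV : t ∈ V
    · simp [htV, l1LeftTranslate_apply]
    · simp [htV]
  have e2 : l1BochnerConv e b - b =
      (((μ.real V)⁻¹ : ℝ) : ℂ) • ∫ t in V, (l1LeftTranslate t b - b) ∂μ := by
    have e3 : μ.real V • b = ((μ.real V : ℝ) : ℂ) • b := (Complex.coe_smul _ _).symm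
    rw [integral_sub hint (integrableOn_const hfin), e1, smul_sub, setIntegral_const, e3, smul_smul,
      ← Complex.ofReal_mul, inv_mul_cancel₀ hpos.ne',
      Complex.ofReal_one, one_smul]
  rw [e2, norm_smul, hn]
  have h3 := norm_setIntegral_le_of_norm_le_const (f := fun t ↦ l1LeftTranslate t b - b)
    hfin.lt_top fun t ht ↦ hb t (hVU ht)
  calc _ ≤ (μ.real V)⁻¹ * (ε * μ.real V) := by gcongr
    _ = ε := by field_simp

lemma l1GroupAlgebra_mul_eq (a b : L1GroupAlgebra μ) : a * b = l1BochnerConv a b := l1Mul_eq a b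

variable (μ) in
lemma exists_l1_left_approximate_identity : ∃ (l : Filter (Set G)) (e : Set G → L1GroupAlgebra μ),
    l.NeBot ∧ (∀ U, ‖e U‖ ≤ 1) ∧ ∀ a, Tendsto (fun U ↦ e U * a) l (𝓝 a) := by
  classical
  let e : Set G → L1GroupAlgebra μ := fun U ↦
    if hU : U ∈ 𝓝 (1 : G) then (exists_l1_approximate_unit (μ := μ) hU).choose else 0
  refine ⟨(𝓝 (1 : G)).smallSets ⊓ 𝓟 {U | U ∈ 𝓝 (1 : G)}, e,
    frequently_mem_iff_neBot.1 (frequently_smallSets_mem _), fun U ↦ ?_, fun a ↦ ?_⟩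
  · simp only [e]
    split_ifs with hU
    · exact (exists_l1_approximate_unit hU).choose_spec.1
    · exact norm_zero.trans_le zero_le_one
  refine Metric.tendsto_nhds.2 fun ε hε ↦ eventually_inf_principal.2 ?_
  have h1 : ∀ᶠ t in 𝓝 (1 : G), ‖l1LeftTranslate t a - a‖ ≤ ε / 2 := by
    have hc : Continuous fun t : G ↦ ‖l1LeftTranslate t a - a‖ :=
      ((l1_translate_continuous a).sub continuous_const).norm
    refine (hc.tendsto 1).eventually (ge_mem_nhds ?_)
    rw [l1LeftTranslate_apply, inv_one, DomMulAct.mk_one, one_smul, sub_self, norm_zero]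
    positivity
  refine eventually_smallSets.2 ⟨_, h1, fun U hUs hU ↦ ?_⟩
  have hU' : U ∈ 𝓝 (1 : G) := hU
  have h2 := (exists_l1_approximate_unit (μ := μ) hU').choose_spec.2 a (ε / 2) fun t ht ↦ hUs ht
  have h3 : e U = (exists_l1_approximate_unit (μ := μ) hU').choose := dif_pos hU'
  rw [dist_eq_norm, l1GroupAlgebra_mul_eq, h3]
  exact lt_of_le_of_lt h2 (half_lt_self hε)

variable (μ) in
lemma isMultiplierAction_l1 :
    IsMultiplierAction (A := L1GroupAlgebra μ) l1RightTranslate l1LeftTranslate where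
  norm_right_le t a := (norm_l1RightTranslate t a).le
  norm_left_le t a := (norm_l1LeftTranslate t a).le
  right_one := l1RightTranslate_one
  left_one a := by
    rw [l1LeftTranslate_apply, inv_one, DomMulAct.mk_one, one_smul]
  left_mul s t a := by
    simp only [l1LeftTranslate_apply, smul_smul, ← DomMulAct.mk_mul, mul_inv_rev]
  mul_comm t a b := by
    rw [l1GroupAlgebra_mul_eq, l1GroupAlgebra_mul_eq]
    exact l1RightTranslate_mul t a b

/-- The defect `φ(af, b) - φ(a, fb)` is the average of the defects for point masses, with
weight `f`. -/
lemma norm_defect_l1_le (φ : L1GroupAlgebra μ →L[ℂ] L1GroupAlgebra μ →L[ℂ] ℂ) {K : ℝ}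
    (hK : ∀ (t : G) (a b : L1GroupAlgebra μ),
      ‖φ (l1RightTranslate t a) b - φ a (l1LeftTranslate t b)‖ ≤ K * (‖a‖ * ‖b‖))
    (a f b : L1GroupAlgebra μ) :
    ‖φ (a * f) b - φ a (f * b)‖ ≤ K * (‖a‖ * ‖f‖ * ‖b‖) := by
  have i1 : Integrable (fun t ↦ f t • l1RightTranslate t a) μ := l1_integrable_smul_rightTranslate f a
  have i2 : Integrable (fun t ↦ f t • l1LeftTranslate t b) μ :=
    l1_integrable_smul_translate (L1.integrable_coeFn f) b
  have e1 : φ (a * f) b = ∫ t, f t * φ (l1RightTranslate t a) b ∂μ := by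
    rw [l1GroupAlgebra_mul_eq, ← l1RightBochnerConv_eq, l1RightBochnerConv_apply]
    have := ContinuousLinearMap.integral_comp_comm (φ.flip b) i1
    simp only [map_smul, ContinuousLinearMap.flip_apply, smul_eq_mul] at this
    exact this.symm
  have e2 : φ a (f * b) = ∫ t, f t * φ a (l1LeftTranslate t b) ∂μ := by
    rw [l1GroupAlgebra_mul_eq, l1BochnerConv_apply]
    have := ContinuousLinearMap.integral_comp_comm (φ a) i2
    simp only [map_smul, smul_eq_mul] at this
    exact this.symm
  have j1 : Integrable (fun t ↦ f t * φ (l1RightTranslate t a) b) μ := by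
    have := (φ.flip b).integrable_comp i1
    simpa only [map_smul, ContinuousLinearMap.flip_apply, smul_eq_mul] using! this
  have j2 : Integrable (fun t ↦ f t * φ a (l1LeftTranslate t b)) μ := by
    have := (φ a).integrable_comp i2
    simpa only [map_smul, smul_eq_mul] using! this
  rw [e1, e2, ← integral_sub j1 j2]
  have e3 : K * (‖a‖ * ‖f‖ * ‖b‖) = ∫ t, ‖f t‖ * (K * (‖a‖ * ‖b‖)) ∂μ := by
    rw [integral_mul_const, ← L1.norm_eq_integral_norm]
    ring
  rw [e3]
  refine norm_integral_le_of_norm_le ((L1.integrable_coeFn f).norm.mul_const _)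
    (ae_of_all _ fun t ↦ ?_)
  rw [← mul_sub, norm_mul]
  exact mul_le_mul_of_nonneg_left (hK t a b) (norm_nonneg _)

end GroupAlgebra

theorem theorem3p3 {G : Type*} [Group G] [TopologicalSpace G] [IsTopologicalGroup G]
    [LocallyCompactSpace G] [MeasurableSpace G] [BorelSpace G]
    (μ : MeasureTheory.Measure G) [μ.IsHaarMeasure] [μ.Regular] :
    IsStronglyZeroProductDetermined (L1GroupAlgebra μ) ∧
      HasStrongPropertyB (L1GroupAlgebra μ) ∧
      zeroProductConst (L1GroupAlgebra μ) ≤ propertyBConst (L1GroupAlgebra μ) ∧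
      propertyBConst (L1GroupAlgebra μ) ≤
        60 * Real.sqrt 27 *
          ((1 + Real.sin (Real.pi / 10)) / (1 - 2 * Real.sin (Real.pi / 10))) := by
  obtain ⟨l, e, hne, he, hl⟩ := exists_l1_left_approximate_identity μ
  have hdist : ∀ φ : L1GroupAlgebra μ →L[ℂ] L1GroupAlgebra μ →L[ℂ] ℂ,
      distProductForms φ ≤ balancedSeminorm φ :=
    distProductForms_le_balancedSeminorm he hl
  set q := (1 + Real.sin (Real.pi / 10)) / (1 - 2 * Real.sin (Real.pi / 10)) with hq
  have hq0 : 0 ≤ q := by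
    have h1 : 0 ≤ Real.sin (Real.pi / 10) :=
      Real.sin_nonneg_of_nonneg_of_le_pi (by positivity) (by linarith [Real.pi_pos])
    have h2 := two_mul_sin_pi_div_ten_lt_one
    exact div_nonneg (by linarith) (by linarith)
  have hB : ∀ φ : L1GroupAlgebra μ →L[ℂ] L1GroupAlgebra μ →L[ℂ] ℂ,
      balancedSeminorm φ ≤ 60 * Real.sqrt 27 * q * zeroProductSeminorm φ := fun φ ↦ by
    have hz := zeroProductSeminorm_nonneg φ
    have h1 : balancedSeminorm φ ≤ 240 * q * zeroProductSeminorm φ :=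
      balancedSeminorm_le (by positivity)
        (norm_defect_l1_le φ ((isMultiplierAction_l1 μ).defect_le φ))
    have h4 : (4 : ℝ) ≤ Real.sqrt 27 := Real.le_sqrt_of_sq_le (by norm_num)
    refine h1.trans ?_
    gcongr
    linarith
  have hC0 : 0 ≤ 60 * Real.sqrt 27 * q := by positivity
  refine ⟨⟨_, fun φ ↦ (hdist φ).trans (hB φ)⟩, ⟨_, hB⟩, ?_, ?_⟩
  · refine csInf_le_csInf ⟨0, fun α hα ↦ hα.1⟩ ⟨_, hC0, hB⟩ fun β hβ ↦ ?_
    exact ⟨hβ.1, fun φ ↦ (hdist φ).trans (hβ.2 φ)⟩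
  · exact csInf_le ⟨0, fun β hβ ↦ hβ.1⟩ ⟨hC0, hB⟩
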